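/- Let $b\ge 2$ and let $T_h$ be the complete tree of height $h$ in which every non-leaf vertex has $b$ children; let $n$ be its number of vertices and $L$ its set of leaves. For $\omega>0$ put $\lambda=\omega(1+\omega)^b$. A boundary condition is a set $\Gamma\subseteq L$. The hard-core model on $T_h$ with activity $\lambda$ and boundary condition $\Gamma$ is the probability measure $\mu_{h,\Gamma}(\sigma)\propto\lambda^{|\sigma|}$ on the set $\Omega_\Gamma$ of independent sets $\sigma$ of $T_h$ with $\sigma\cap L=\Gamma$. Its (heat bath) Glauber dynamics picks a uniformly random vertex $v$ of $T_h$; if $v\in L$ nothing changes; otherwise, if all neighbours of $v$ are unoccupied, $v$ becomes occupied with probability $\lambda/(1+\lambda)$ and unoccupied with probability $1/(1+\lambda)$, and if some neighbour is occupied, $v$ is unoccupied. With $\gamma_1\ge\gamma_2\ge\dots\ge\gamma_{|\Omega_\Gamma|}$ the eigenvalues of the transition matrix, the relaxation time is $T_{\mathrm{rel}}=(1-\max\{\gamma_2,|\gamma_{|\Omega_\Gamma|}|\})^{-1}$. For a boundary condition $\Gamma$ on $T_h$ let $Q(\Gamma)=\dfrac{\mu_{h,\Gamma}(r\in\sigma)}{\omega\,\mu_{h,\Gamma}(r\notin\sigma)}$,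 where $r$ is the root. Boundary conditions $\Gamma^U_h,\Gamma^L_h$ on $T_h$ ($h\ge1$) are defined recursively. On $T_1$ let $\Gamma^U_1=\emptyset$ and $\Gamma^L_1=L$. Given $\Gamma^U_h,\Gamma^L_h$, put, for $0\le\ell\le b$, $$Q_\ell=\frac{(1+\omega)^b}{(1+\omega Q(\Gamma^U_h))^{\ell}(1+\omega Q(\Gamma^L_h))^{b-\ell}},$$ let $t$ be the $\ell$ that minimises $Q_\ell$ subject to $Q_\ell\ge1$, and $s$ the $\ell$ that maximises $Q_\ell$ subject to $Q_\ell\le1$ (ties, which occur only if $\Gamma^U_h=\Gamma^L_h$, are broken towards the largest $\ell$). Then $\Gamma^U_{h+1}$ is $\Gamma^U_h$ on the subtrees of the first $t$ children of the root of $T_{h+1}$ and $\Gamma^L_h$ on the subtrees of the other $b-t$ children; $\Gamma^L_{h+1}$ is defined in the same way with $s$ in place of $t$. For $\delta>0$ and an integer $b\ge2$ let $\omega=\omega(\delta,b)=(1+\delta)\ln b/b$ and $\lambda=\omega(1+\omega)^b$, and let $b_0(\delta)$ be the least integer $b_0\ge2$ such that $\exp\!\big(2(1.01)(\omega b)^2/\lambda\big)\le1.01$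 for all integers $b\ge b_0$. **Theorem.** Let $\delta>0$. 1. For every integer $b\ge b_0(\delta)$, with $\omega=(1+\delta)\ln b/b$, the relaxation time of the Glauber dynamics of the hard-core model on $T_h$ with boundary condition $\Gamma^U_h$, and also that with boundary condition $\Gamma^L_h$, satisfies $$T_{\mathrm{rel}}=\Omega(n^{d})\quad(h\to\infty),\qquad d=1+\frac{\ln\big(\lambda/(1.01\,\omega b)^2\big)}{2\ln b},$$ where the implied constant may depend on $\delta$ and $b$. 2. Consequently, there is a function $g$ (which may depend on $\delta$) with $g(b)=O(\ln\ln b/\ln b)$ as $b\to\infty$ such that for every integer $b\ge2$, with $\omega=(1+\delta)\ln b/b$, there is a sequence of boundary conditions $\Gamma_h$ on $T_h$, $h\to\infty$, for which $T_{\mathrm{rel}}=\Omega(n^{1+\delta/2-g(b)})$. -/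

import Mathlib

open Filter Asymptotics

noncomputable section

namespace HardCore

/-! ### The hard-core model with a boundary condition on a finite graph

`L` is the set of vertices whose state is prescribed (for a tree, the leaves) and `Γ ⊆ L` is the
set of those that are prescribed to be occupied. -/

section Model

variable {V : Type} [Fintype V] [DecidableEq V]

/-- The state space `Ω_Γ`: the independent sets `σ` of `G` with `σ ∩ L = Γ`. -/
abbrev Config (G : SimpleGraph V) (L Γ : Set V) : Type :=
  {σ : Finset V // G.IsIndepSet (σ : Set V) ∧ (σ : Set V) ∩ L = Γ}

instance (G : SimpleGraph V) (L Γ : Set V) : Fintype (Config G L Γ) := Fintype.ofFinite _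

/-- The Gibbs measure `μ(σ) = lam ^ |σ| / Z` on `Ω_Γ`. -/
def gibbs (G : SimpleGraph V) (lam : ℝ) (L Γ : Set V) (σ : Config G L Γ) : ℝ :=
  lam ^ σ.1.card / ∑ τ : Config G L Γ, lam ^ τ.1.card

/-- The probability under the Gibbs measure that the vertex `v` is occupied. -/
def probOcc (G : SimpleGraph V) (lam : ℝ) (L Γ : Set V) (v : V) : ℝ :=
  ∑ σ : Config G L Γ, if v ∈ σ.1 then gibbs G lam L Γ σ else 0

/-- The probability under the Gibbs measure that the vertex `v` is unoccupied. -/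
def probUnocc (G : SimpleGraph V) (lam : ℝ) (L Γ : Set V) (v : V) : ℝ :=
  ∑ σ : Config G L Γ, if v ∈ σ.1 then 0 else gibbs G lam L Γ σ

open Classical in
/-- The probability to move from `σ` to `τ` in one step of the heat-bath Glauber dynamics, given
that the vertex `v` has been chosen: vertices of `L` keep their prescribed state, and another
vertex becomes occupied with probability `lam / (1 + lam)` if all its neighbours are unoccupied,
and becomes unoccupied otherwise. -/
def siteUpdate (G : SimpleGraph V) (lam : ℝ) (L Γ : Set V) (v : V) (σ τ : Config G L Γ) : ℝ :=
  if v ∈ L then (if τ.1 = σ.1 then 1 else 0)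
  else if ∀ w, G.Adj v w → w ∉ σ.1 then
    (lam / (1 + lam)) * (if τ.1 = insert v σ.1 then 1 else 0)
      + (1 / (1 + lam)) * (if τ.1 = σ.1.erase v then 1 else 0)
  else (if τ.1 = σ.1.erase v then 1 else 0)

/-- The transition matrix of the Glauber dynamics on `Ω_Γ`: the vertex to be updated is chosen
uniformly at random among all vertices. -/
def glauber (G : SimpleGraph V) (lam : ℝ) (L Γ : Set V) :
    Matrix (Config G L Γ) (Config G L Γ) ℝ :=
  Matrix.of fun σ τ => (∑ v : V, siteUpdate G lam L Γ v σ τ) / (Fintype.card V : ℝ)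

end Model

/-! ### Relaxation time -/

section Relaxation

variable {S : Type} [Fintype S] [DecidableEq S]

/-- The real eigenvalues `γ₁ ≥ γ₂ ≥ …` of a matrix, listed with multiplicity in decreasing order
(for a reversible transition matrix these are all the eigenvalues). -/
def eigenvalueList (P : Matrix S S ℝ) : List ℝ :=
  P.charpoly.roots.sort (fun x y => x ≥ y)

/-- The spectral gap `1 - max {γ₂, |γ_|S||}` of a transition matrix (with at least two states). -/
def spectralGap (P : Matrix S S ℝ) : ℝ :=
  1 - max ((eigenvalueList P).getD 1 0) |(eigenvalueList P).getLastD 0|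

/-- The relaxation time, the inverse of the spectral gap. -/
def relaxationTime (P : Matrix S S ℝ) : ℝ := (spectralGap P)⁻¹

end Relaxation

/-! ### The complete tree -/

/-- The vertices of the complete tree `T_h` with branching factor `b`: words of length at most `h`
over `{0, …, b - 1}`, giving the successive choices of a child on the way from the root. -/
abbrev Vertex (b h : ℕ) : Type := {v : List (Fin b) // v.length ≤ h}

instance (b h : ℕ) : Finite (Vertex b h) := (List.finite_length_le (Fin b) h).to_subtype

instance (b h : ℕ) : Fintype (Vertex b h) := Fintype.ofFinite _

/-- The complete tree `T_h` with branching factor `b`: the children of `v` are the words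
`v ++ [j]`. -/
def tree (b h : ℕ) : SimpleGraph (Vertex b h) :=
  SimpleGraph.fromRel fun v w => ∃ j : Fin b, w.1 = v.1 ++ [j]

/-- The root of `T_h`. -/
def root (b h : ℕ) : Vertex b h := ⟨[], Nat.zero_le h⟩

/-- The leaves of `T_h`. -/
def leaves (b h : ℕ) : Set (Vertex b h) := {v | v.1.length = h}

/-- The copy of the vertex `v` of `T_h` in the subtree of `T_{h+1}` that hangs from the `j`-th
child of the root. -/
def below {b h : ℕ} (j : Fin b) (v : Vertex b h) : Vertex b (h + 1) :=
  ⟨j :: v.1, Nat.succ_le_succ v.2⟩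

/-- The number of vertices of `T_h`. -/
def numVertices (b h : ℕ) : ℕ := Fintype.card (Vertex b h)

/-- The relaxation time of the Glauber dynamics of the hard-core model with activity `lam` on `T_h`
with boundary condition `Γ`. -/
def treeRelaxationTime (b h : ℕ) (lam : ℝ) (Γ : Set (Vertex b h)) : ℝ :=
  relaxationTime (glauber (tree b h) lam (leaves b h) Γ)

/-! ### The boundary conditions `Γ^U_h` and `Γ^L_h` -/

/-- The activity `lam = ω (1 + ω) ^ b`. -/
def activity (b : ℕ) (ω : ℝ) : ℝ := ω * (1 + ω) ^ b

/-- The `Q`-value `μ(σ(r) = 1) / (ω μ(σ(r) = 0))` of `T_h` with boundary condition `Γ`. -/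
def qValue (b h : ℕ) (ω : ℝ) (Γ : Set (Vertex b h)) : ℝ :=
  probOcc (tree b h) (activity b ω) (leaves b h) Γ (root b h) /
    (ω * probUnocc (tree b h) (activity b ω) (leaves b h) Γ (root b h))

/-- The `Q`-value of a tree whose root has `l` children with `Q`-value `qU` and `b - l` children
with `Q`-value `qL`. -/
def mixedQ (b : ℕ) (ω qU qL : ℝ) (l : ℕ) : ℝ :=
  (1 + ω) ^ b / ((1 + ω * qU) ^ l * (1 + ω * qL) ^ (b - l))

/-- The number `t` of copies of `U_i` in `U_{i+1}`: it minimises the resulting `Q`-value among the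
choices for which that value is at least `1` (ties, which occur only when `U_i = L_i`, are broken
towards the largest choice). -/
def upperCount (b : ℕ) (ω qU qL : ℝ) : ℕ :=
  sSup {l | l ≤ b ∧ 1 ≤ mixedQ b ω qU qL l ∧
    ∀ k ≤ b, 1 ≤ mixedQ b ω qU qL k → mixedQ b ω qU qL l ≤ mixedQ b ω qU qL k}

/-- The number `s` of copies of `U_i` in `L_{i+1}`: it maximises the resulting `Q`-value among the
choices for which that value is at most `1` (same rule for ties). -/
def lowerCount (b : ℕ) (ω qU qL : ℝ) : ℕ :=
  sSup {l | l ≤ b ∧ mixedQ b ω qU qL l ≤ 1 ∧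
    ∀ k ≤ b, mixedQ b ω qU qL k ≤ 1 → mixedQ b ω qU qL k ≤ mixedQ b ω qU qL l}

/-- The boundary condition on `T_{h+1}` that is `A` on the subtrees of the first `l` children of
the root and `B` on the subtrees of the other children. -/
def glue {b h : ℕ} (l : ℕ) (A B : Set (Vertex b h)) : Set (Vertex b (h + 1)) :=
  {v | ∃ j : Fin b, ∃ u : Vertex b h, v = below j u ∧ if j.val < l then u ∈ A else u ∈ B}

/-- The pair `(Γ^U_{k+1}, Γ^L_{k+1})` of boundary conditions on `T_{k+1}`. On `T_1` all leaves are
unoccupied in `Γ^U_1` (so that the root is free), and all are occupied in `Γ^L_1` (so that the root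
is blocked). -/
def boundaryPair (b : ℕ) (ω : ℝ) : (k : ℕ) → Set (Vertex b (k + 1)) × Set (Vertex b (k + 1))
  | 0 => (∅, leaves b 1)
  | k + 1 =>
    let A := (boundaryPair b ω k).1
    let B := (boundaryPair b ω k).2
    let qU := qValue b (k + 1) ω A
    let qL := qValue b (k + 1) ω B
    (glue (upperCount b ω qU qL) A B, glue (lowerCount b ω qU qL) A B)

/-- The boundary condition `Γ^U_{k+1}` on `T_{k+1}`. -/
def gammaU (b : ℕ) (ω : ℝ) (k : ℕ) : Set (Vertex b (k + 1)) := (boundaryPair b ω k).1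

/-- The boundary condition `Γ^L_{k+1}` on `T_{k+1}`. -/
def gammaL (b : ℕ) (ω : ℝ) (k : ℕ) : Set (Vertex b (k + 1)) := (boundaryPair b ω k).2

/-! ### Parameters -/

/-- `ω = (1 + δ) ln b / b`. -/
def omegaOf (δ : ℝ) (b : ℕ) : ℝ := (1 + δ) * Real.log b / b

/-- The threshold `b₀(δ)`: the least `b₀ ≥ 2` such that `exp (2 (1.01) (ω b)² / lam) ≤ 1.01` for all
`b ≥ b₀`, where `ω = (1 + δ) ln b / b` and `lam = ω (1 + ω) ^ b`. -/
def bZero (δ : ℝ) : ℕ :=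
  sInf {b₀ | 2 ≤ b₀ ∧ ∀ b : ℕ, b₀ ≤ b →
    Real.exp (2 * 1.01 * (omegaOf δ b * b) ^ 2 / activity b (omegaOf δ b)) ≤ 1.01}

/-- The exponent `d = 1 + ln (lam / (1.01 ω b)²) / (2 ln b)`. -/
def exponent (b : ℕ) (ω : ℝ) : ℝ :=
  1 + Real.log (activity b ω / (1.01 * ω * b) ^ 2) / (2 * Real.log b)

end HardCore

end

/-!
The proof bounds the spectral gap from above by the Rayleigh quotient of an indicator function, the
event that a recursive reconstruction of the state of the root declares the root to be occupied.

*Reconstruction.* Fix a height `m`. At height `m` the true states are read off, and above it a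
vertex is declared occupied if and only if all of its children are declared unoccupied (`recon`).
If the `Q`-values of all subtrees are close to `1`, an unoccupied vertex has `b` unoccupied
children with probability about `(1 + ω) ^ (-b) = ω / lam`. Writing `a = 1.01 ω / lam`, the
reconstruction therefore errs with probability at most `a` at an unoccupied vertex and at most
`b a` at an occupied one, provided that `exp ((ω b)² / lam)` is close to `1`; this is what the
definition of `b₀` ensures. So the event and its complement both have probability bounded below.

*Pivotal vertices.* A single update changes the outcome only at a vertex of height `m` that is
pivotal, which means that all siblings of all vertices on its way to the root are declared
unoccupied. The expected number of pivotal vertices obeys a linear recursion in the pair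
(root unoccupied, root occupied): one level from an occupied root costs a factor `b`, and one level
from an unoccupied root a factor `b a`, after which the child is occupied with relative weight `ω`.
The growth rate of this recursion is at most `φ = 1.01 ω b / √lam`, as `√lam ≥ 101`. Both
recursions are in `ReconBound.succ`; they rest on the independence of the subtrees given the state
of the root (`W0_prod`, `W1_prod`). As `φ = b ^ (-(d - 1))`, the Dirichlet form of the event is of
order `n⁻¹ φ ^ h = O (n ^ (-d))`.

*Boundary conditions.* The `Q`-values of `Γ^U_h` and `Γ^L_h` lie on the two sides of `1`, and
their ratio `R` satisfies `R' - 1 ≤ (R - 1) ω / (1 + ω)`, since the two new values are at most one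
replacement of a subtree apart (`mixedQ_upper_le_lower`). They tend to `1`, which makes the
recursion above applicable from a fixed height on (`exists_le_treeRelaxationTime`).

*Spectral gap.* The relaxation time is an inverse, so the gap must be shown to be positive as well.
The chain is reversible, irreducible through the configuration `Γ`, and has positive holding
probabilities, so `1` is a simple eigenvalue and `-1` is not an eigenvalue
(`spectralGap_pos_and_le`).

*Second part.* Expanding logarithms, `d = 1 + δ / 2 + O (ln ln b / ln b)`. For the finitely many
`b < b₀` the function `g` makes the exponent zero, where positivity of the gap suffices.
-/

noncomputable section

namespace HardCore

/-! ### The spectral gap of a reversible chain -/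

section Spectral

variable {S : Type} [Fintype S]

/-- A matrix satisfying detailed balance is self-adjoint for the inner product weighted by `π`. -/
lemma sum_mul_mulVec_comm {P : Matrix S S ℝ} {π : S → ℝ}
    (hrev : ∀ x y, π x * P x y = π y * P y x) (f g : S → ℝ) :
    ∑ x, π x * (f x * (P.mulVec g) x) = ∑ x, π x * (g x * (P.mulVec f) x) := by
  simp only [Matrix.mulVec, dotProduct, Finset.mul_sum]
  rw [Finset.sum_comm]
  refine Finset.sum_congr rfl fun x _ => Finset.sum_congr rfl fun y _ => ?_
  linear_combination (f y * g x) * hrev y x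

/-- The Dirichlet form, with a sign: `c = 1` gives the usual one, `c = -1` the one that controls
the bottom of the spectrum. -/
lemma sum_mul_sq_sub {P : Matrix S S ℝ} {π : S → ℝ}
    (hrev : ∀ x y, π x * P x y = π y * P y x) (hrow : ∀ x, ∑ y, P x y = 1)
    (c : ℝ) (hc : c ^ 2 = 1) (f : S → ℝ) :
    ∑ x, ∑ y, π x * P x y * (f x - c * f y) ^ 2 =
      2 * (∑ x, π x * (f x * f x) - c * ∑ x, π x * (f x * (P.mulVec f) x)) := by
  have h1 : ∑ x, ∑ y, π x * P x y * (f x * f x) = ∑ x, π x * (f x * f x) := by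
    refine Finset.sum_congr rfl fun x _ => ?_
    rw [← Finset.sum_mul, ← Finset.mul_sum, hrow, mul_one]
  have h2 : ∑ x, ∑ y, π x * P x y * (f y * f y) = ∑ x, π x * (f x * f x) := by
    rw [Finset.sum_comm, ← h1]
    exact Finset.sum_congr rfl fun x _ => Finset.sum_congr rfl fun y _ => by rw [hrev]
  have h3 : ∑ x, ∑ y, π x * P x y * (f x * f y) = ∑ x, π x * (f x * (P.mulVec f) x) := by
    refine Finset.sum_congr rfl fun x _ => ?_
    simp only [Matrix.mulVec, dotProduct, Finset.mul_sum]
    exact Finset.sum_congr rfl fun y _ => by ring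
  have : ∀ x y, π x * P x y * (f x - c * f y) ^ 2 = π x * P x y * (f x * f x) +
      π x * P x y * (f y * f y) - 2 * c * (π x * P x y * (f x * f y)) := by
    intro x y
    linear_combination (π x * P x y * (f y * f y)) * hc
  simp only [this, Finset.sum_sub_distrib, Finset.sum_add_distrib, ← Finset.mul_sum, h1, h2, h3]
  ring

variable [DecidableEq S]

/-- A matrix satisfying detailed balance has an eigenbasis that is orthonormal for the inner
product weighted by `π`, and its eigenvalues, with multiplicity, are the roots of its
characteristic polynomial. -/
lemma exists_eigenbasis_of_reversible {P : Matrix S S ℝ} {π : S → ℝ} (hπ : ∀ x, 0 < π x)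
    (hrev : ∀ x y, π x * P x y = π y * P y x) :
    ∃ (μ : S → ℝ) (e : S → S → ℝ),
      P.charpoly.roots = Finset.univ.val.map μ ∧
      (∀ i, P.mulVec (e i) = μ i • e i) ∧
      (∀ i j, ∑ x, π x * (e i x * e j x) = if i = j then 1 else 0) ∧
      (∀ f g : S → ℝ, ∑ x, π x * (f x * g x) =
        ∑ i, (∑ x, π x * (f x * e i x)) * (∑ x, π x * (g x * e i x))) := by
  -- conjugating by `diagonal √π` makes the matrix symmetric
  set s : S → ℝ := fun x => √(π x) with hs
  have hs0 : ∀ x, s x ≠ 0 := fun x => (Real.sqrt_pos.2 (hπ x)).ne'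
  have hss : ∀ x, s x * s x = π x := fun x => Real.mul_self_sqrt (hπ x).le
  let U : (Matrix S S ℝ)ˣ := ⟨Matrix.diagonal s, Matrix.diagonal fun x => (s x)⁻¹,
    by rw [Matrix.diagonal_mul_diagonal]; simp [hs0],
    by rw [Matrix.diagonal_mul_diagonal]; simp [hs0]⟩
  set A : Matrix S S ℝ := U.val * P * U⁻¹.val with hA
  have hAe : ∀ x y, A x y = s x * P x y * (s y)⁻¹ := by
    intro x y
    simp [hA, U]
  have hAh : A.IsHermitian := by
    ext x y
    rw [Matrix.conjTranspose_apply, hAe, hAe, star_trivial]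
    have := hrev x y
    rw [← hss, ← hss] at this
    field_simp [hs0 x, hs0 y]
    linear_combination -this
  have hchar : A.charpoly = P.charpoly := by
    rw [hA, Matrix.coe_units_inv]; exact Matrix.charpoly_units_conj U P
  set v := hAh.eigenvectorBasis with hv
  have hπe : ∀ i x, π x * (v i x / s x) = s x * v i x := by
    intro i x
    rw [← hss]; field_simp [hs0 x]
  refine ⟨hAh.eigenvalues, fun i x => v i x / s x, ?_, ?_, ?_, ?_⟩
  · rw [← hchar, hAh.roots_charpoly_eq_eigenvalues]; rfl
  · intro i
    ext x
    have h := congrFun (hAh.mulVec_eigenvectorBasis i) x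
    simp only [Matrix.mulVec, dotProduct, Pi.smul_apply, smul_eq_mul, hAe] at h ⊢
    rw [mul_div_assoc', ← h, Finset.sum_div]
    refine Finset.sum_congr rfl fun y _ => ?_
    field_simp [hs0 x, hs0 y]
    rfl
  · intro i j
    have h := orthonormal_iff_ite.1 v.orthonormal j i
    rw [PiLp.inner_apply] at h
    simp only [eq_comm (a := i) (b := j)]
    rw [← h]
    refine Finset.sum_congr rfl fun x _ => ?_
    have : π x * (v i x / s x * (v j x / s x)) = (π x * (v i x / s x)) * (v j x / s x) := by ring
    rw [this, hπe]
    field_simp [hs0 x]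
    simp
  · intro f g
    have h := v.sum_inner_mul_inner (WithLp.toLp 2 fun x => s x * f x)
      (WithLp.toLp 2 fun x => s x * g x)
    simp only [PiLp.inner_apply, RCLike.inner_apply, conj_trivial] at h
    have e1 : ∀ x, π x * (f x * g x) = s x * g x * (s x * f x) := fun x => by rw [← hss]; ring
    have e2 : ∀ (f : S → ℝ) (i x), π x * (f x * (v i x / s x)) = s x * f x * v i x := fun f i x => by
      rw [mul_left_comm, hπe]; ring
    simp only [e1, e2]
    rw [← h]
    refine Finset.sum_congr rfl fun i _ => ?_
    congr 1
    exact Finset.sum_congr rfl fun x _ => mul_comm _ _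

/-- Let `a` be the largest eigenvalue, attained at the index `i₀` only. The second entry of the
eigenvalue list is then the largest among the other indices, and the last entry, too, belongs to
another index. -/
lemma eigenvalueList_of_roots {P : Matrix S S ℝ} {μ : S → ℝ}
    (hroots : P.charpoly.roots = Finset.univ.val.map μ) {i₀ : S} (hle : ∀ i, μ i ≤ μ i₀)
    (hcard : ∃ i, i ≠ i₀) :
    (∃ i, i ≠ i₀ ∧ (eigenvalueList P).getD 1 0 = μ i) ∧
    (∀ i, i ≠ i₀ → μ i ≤ (eigenvalueList P).getD 1 0) ∧
    (∃ i, i ≠ i₀ ∧ (eigenvalueList P).getLastD 0 = μ i) := by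
  set m : Multiset ℝ := (Finset.univ.erase i₀).val.map μ with hm
  have hsplit : P.charpoly.roots = μ i₀ ::ₘ m := by
    rw [hroots, hm, ← Multiset.map_cons, ← Finset.cons_val (Finset.notMem_erase i₀ _),
      Finset.cons_eq_insert, Finset.insert_erase (Finset.mem_univ _)]
  have hmem : ∀ a, a ∈ m ↔ ∃ i, i ≠ i₀ ∧ μ i = a := by
    intro a; rw [hm, Multiset.mem_map]; simp only [Finset.mem_val, Finset.mem_erase, Finset.mem_univ, and_true]
  have hlist : eigenvalueList P = μ i₀ :: m.sort (fun x y => x ≥ y) := by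
    rw [eigenvalueList, hsplit, Multiset.sort_cons]
    intro b hb
    obtain ⟨i, -, rfl⟩ := (hmem b).1 hb
    exact hle i
  have hsorted := Multiset.pairwise_sort m (fun x y : ℝ => x ≥ y)
  have hms : ∀ a, a ∈ m.sort (fun x y : ℝ => x ≥ y) ↔ ∃ i, i ≠ i₀ ∧ μ i = a := by
    intro a; rw [Multiset.mem_sort, hmem]
  rw [hlist]
  generalize m.sort (fun x y : ℝ => x ≥ y) = l at hsorted hms
  cases l with
  | nil =>
    obtain ⟨i, hi⟩ := hcard
    exact absurd ((hms (μ i)).2 ⟨i, hi, rfl⟩) (by simp)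
  | cons c l =>
    refine ⟨?_, ?_, ?_⟩
    · obtain ⟨i, hi, h⟩ := (hms c).1 (by simp)
      exact ⟨i, hi, by simp [h]⟩
    · intro i hi
      have h := (hms (μ i)).2 ⟨i, hi, rfl⟩
      simp only [List.getD_cons_succ, List.getD_cons_zero]
      rcases List.mem_cons.1 h with h | h
      · exact h.le
      · exact List.rel_of_pairwise_cons hsorted h
    · have : (μ i₀ :: c :: l).getLastD 0 ∈ c :: l := by
        simp only [List.getLastD_cons]
        exact List.getLastD_mem_cons
      obtain ⟨i, hi, h⟩ := (hms _).1 this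
      exact ⟨i, hi, h.symm⟩

lemma spectralGap_le_one (P : Matrix S S ℝ) : spectralGap P ≤ 1 := by
  have : 0 ≤ max ((eigenvalueList P).getD 1 0) |(eigenvalueList P).getLastD 0| :=
    (abs_nonneg _).trans (le_max_right _ _)
  simp only [spectralGap]; linarith

/-- The spectral gap of an irreducible reversible chain with positive holding probabilities is
positive, and the Rayleigh quotient of every centred function bounds it from above. -/
theorem spectralGap_pos_and_le {P : Matrix S S ℝ} {π : S → ℝ} (hπ : ∀ x, 0 < π x)
    (hrev : ∀ x y, π x * P x y = π y * P y x) (hrow : ∀ x, ∑ y, P x y = 1)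
    (hnn : ∀ x y, 0 ≤ P x y) (hdiag : ∀ x, 0 < P x x)
    (hirr : ∀ f : S → ℝ, (∀ x y, 0 < P x y → f x = f y) → ∀ x y, f x = f y)
    (hcard : ∃ x y : S, x ≠ y) :
    0 < spectralGap P ∧ ∀ f : S → ℝ, ∑ x, π x * f x = 0 →
      spectralGap P * ∑ x, π x * (f x * f x) ≤
        ∑ x, π x * (f x * f x) - ∑ x, π x * (f x * (P.mulVec f) x) := by
  obtain ⟨μ, e, hroots, heig, horth, hpars⟩ := exists_eigenbasis_of_reversible hπ hrev
  have hform : ∀ i, ∑ x, π x * (e i x * (P.mulVec (e i)) x) = μ i := by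
    intro i
    have h := horth i i
    rw [if_pos rfl] at h
    rw [heig, ← mul_one (μ i)]
    conv_rhs => rw [← h, Finset.mul_sum]
    exact Finset.sum_congr rfl fun x _ => by simp only [Pi.smul_apply, smul_eq_mul]; ring
  have hnonneg : ∀ (f : S → ℝ) (c : ℝ) (x y : S), 0 ≤ π x * P x y * (f x - c * f y) ^ 2 :=
    fun f c x y => mul_nonneg (mul_nonneg (hπ x).le (hnn x y)) (sq_nonneg _)
  have hzero : ∀ (i : S) (c : ℝ), c ^ 2 = 1 → c * μ i = 1 →
      ∀ x y, 0 < P x y → e i x = c * e i y := by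
    intro i c hc hμ x y hxy
    have h := sum_mul_sq_sub hrev hrow c hc (e i)
    rw [hform, horth, if_pos rfl, hμ, sub_self, mul_zero,
      Finset.sum_eq_zero_iff_of_nonneg fun x _ => Finset.sum_nonneg fun y _ => hnonneg _ _ _ _] at h
    have h := h x (Finset.mem_univ _)
    rw [Finset.sum_eq_zero_iff_of_nonneg fun y _ => hnonneg _ _ _ _] at h
    have h := h y (Finset.mem_univ _)
    have := pow_eq_zero_iff (two_ne_zero) |>.1
      ((mul_eq_zero.1 h).resolve_left (mul_pos (hπ x) hxy).ne')
    linarith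
  have hbound : ∀ (i : S) (c : ℝ), c ^ 2 = 1 → c * μ i ≤ 1 := by
    intro i c hc
    have h := sum_mul_sq_sub hrev hrow c hc (e i)
    rw [hform, horth, if_pos rfl] at h
    have : 0 ≤ ∑ x, ∑ y, π x * P x y * (e i x - c * e i y) ^ 2 :=
      Finset.sum_nonneg fun x _ => Finset.sum_nonneg fun y _ => hnonneg _ _ _ _
    linarith
  have hle1 : ∀ i, μ i ≤ 1 := fun i => by simpa using hbound i 1 (by norm_num)
  have hgt : ∀ i, -1 < μ i := by
    intro i
    refine lt_of_le_of_ne (by linarith [hbound i (-1) (by norm_num)]) fun h => ?_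
    have h0 : ∀ x, e i x = 0 := fun x => by
      have := hzero i (-1) (by norm_num) (by linarith) x x (hdiag x)
      linarith
    have := horth i i
    simp [h0] at this
  have hconst : ∀ i, μ i = 1 → ∀ x y, e i x = e i y := fun i hi =>
    hirr _ fun x y hxy => by simpa using hzero i 1 (by norm_num) (by simpa using hi) x y hxy
  obtain ⟨x₀, y₀, hxy⟩ := hcard
  -- the constants are an eigenvector with eigenvalue `1`
  have hex : ∃ i₀, μ i₀ = 1 := by
    by_contra! hne
    have hc : ∀ i, ∑ x, π x * ((1 : ℝ) * e i x) = 0 := by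
      intro i
      have h := sum_mul_mulVec_comm hrev (e i) (fun _ => 1)
      have h1 : P.mulVec (fun _ => (1 : ℝ)) = fun _ => 1 := by
        ext x; simp [Matrix.mulVec, dotProduct, hrow]
      rw [h1, heig] at h
      simp only [mul_one, one_mul, Pi.smul_apply, smul_eq_mul] at h ⊢
      have h2 : ∑ x, π x * (μ i * e i x) = μ i * ∑ x, π x * e i x := by
        rw [Finset.mul_sum]; exact Finset.sum_congr rfl fun x _ => by ring
      rw [h2] at h
      have h3 : (1 - μ i) * ∑ x, π x * e i x = 0 := by linarith
      exact (mul_eq_zero.1 h3).resolve_left (sub_ne_zero.2 (hne i).symm)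
    have h := hpars (fun _ => 1) (fun _ => 1)
    simp only [hc, mul_one, mul_zero, Finset.sum_const_zero] at h
    have : 0 < ∑ x, π x := Finset.sum_pos (fun x _ => hπ x) ⟨x₀, Finset.mem_univ _⟩
    linarith
  obtain ⟨i₀, hi₀⟩ := hex
  have hlt1 : ∀ i, i ≠ i₀ → μ i < 1 := by
    intro i hi
    refine lt_of_le_of_ne (hle1 i) fun h => ?_
    have h1 := horth i i
    have h2 := horth i₀ i₀
    have h3 := horth i i₀
    rw [if_pos rfl] at h1 h2
    rw [if_neg hi] at h3
    have c1 : ∀ x, e i x = e i x₀ := fun x => hconst i h x x₀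
    have c2 : ∀ x, e i₀ x = e i₀ x₀ := fun x => hconst i₀ hi₀ x x₀
    simp only [c1, c2, ← Finset.sum_mul] at h1 h2 h3
    have h4 : (∑ x, π x) * (e i x₀ * e i x₀) * ((∑ x, π x) * (e i₀ x₀ * e i₀ x₀)) =
      ((∑ x, π x) * (e i x₀ * e i₀ x₀)) * ((∑ x, π x) * (e i x₀ * e i₀ x₀)) := by ring
    rw [h1, h2, h3] at h4
    norm_num at h4
  have hcard' : ∃ i, i ≠ i₀ := by
    by_cases h : x₀ = i₀
    · exact ⟨y₀, fun h' => hxy (h.trans h'.symm)⟩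
    · exact ⟨x₀, h⟩
  obtain ⟨⟨i₁, hi₁, h₁⟩, hsec, ⟨i₂, hi₂, h₂⟩⟩ :=
    eigenvalueList_of_roots hroots (fun i => (hle1 i).trans hi₀.ge) hcard'
  refine ⟨?_, fun f hf => ?_⟩
  · rw [spectralGap, h₁, h₂, sub_pos]
    exact max_lt (hlt1 _ hi₁) (abs_lt.2 ⟨hgt _, hlt1 _ hi₂⟩)
  · set γ := (eigenvalueList P).getD 1 0 with hγ
    have hgap : spectralGap P ≤ 1 - γ := by
      rw [spectralGap]; linarith [le_max_left γ |(eigenvalueList P).getLastD 0|]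
    have hff := hpars f f
    have hfP := hpars f (P.mulVec f)
    have hPe : ∀ i, ∑ x, π x * ((P.mulVec f) x * e i x) = μ i * ∑ x, π x * (f x * e i x) := by
      intro i
      have h := sum_mul_mulVec_comm hrev (e i) f
      rw [heig] at h
      rw [Finset.mul_sum]
      calc _ = ∑ x, π x * (e i x * (P.mulVec f) x) :=
            Finset.sum_congr rfl fun x _ => by ring
        _ = _ := h
        _ = _ := Finset.sum_congr rfl fun x _ => by simp only [Pi.smul_apply, smul_eq_mul]; ring
    have hc0 : ∑ x, π x * (f x * e i₀ x) = 0 := by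
      have c2 : ∀ x, e i₀ x = e i₀ x₀ := fun x => hconst i₀ hi₀ x x₀
      calc _ = (∑ x, π x * f x) * e i₀ x₀ := by
            rw [Finset.sum_mul]; exact Finset.sum_congr rfl fun x _ => by rw [c2]; ring
        _ = 0 := by rw [hf, zero_mul]
    have hmain : ∑ x, π x * (f x * (P.mulVec f) x) ≤ γ * ∑ x, π x * (f x * f x) := by
      rw [hff, hfP, Finset.mul_sum]
      refine Finset.sum_le_sum fun i _ => ?_
      rw [hPe]
      by_cases hi : i = i₀
      · rw [hi, hc0]; simp
      · nlinarith [hsec i hi, mul_self_nonneg (∑ x, π x * (f x * e i x))]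
    have hff0 : 0 ≤ ∑ x, π x * (f x * f x) :=
      Finset.sum_nonneg fun x _ => mul_nonneg (hπ x).le (mul_self_nonneg _)
    nlinarith [mul_le_mul_of_nonneg_right hgap hff0]

end Spectral

/-! ### The Glauber dynamics on a finite graph -/

section Glauber

variable {V : Type}

open Classical in
/-- The weight `lam ^ |σ|` of a set of vertices `σ`, which is zero unless `σ ∈ Ω_Γ`. -/
def weight (G : SimpleGraph V) (lam : ℝ) (L Γ : Set V) (σ : Finset V) : ℝ :=
  if G.IsIndepSet (σ : Set V) ∧ (σ : Set V) ∩ L = Γ then lam ^ σ.card else 0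

lemma weight_of {G : SimpleGraph V} {lam : ℝ} {L Γ : Set V} {σ : Finset V}
    (h : G.IsIndepSet (σ : Set V) ∧ (σ : Set V) ∩ L = Γ) : weight G lam L Γ σ = lam ^ σ.card :=
  if_pos h

lemma weight_of_not {G : SimpleGraph V} {lam : ℝ} {L Γ : Set V} {σ : Finset V}
    (h : ¬ (G.IsIndepSet (σ : Set V) ∧ (σ : Set V) ∩ L = Γ)) : weight G lam L Γ σ = 0 :=
  if_neg h

lemma weight_nonneg {G : SimpleGraph V} {lam : ℝ} {L Γ : Set V} (hlam : 0 < lam) (σ : Finset V) :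
    0 ≤ weight G lam L Γ σ := by
  unfold weight; split_ifs <;> positivity

variable [Fintype V]

/-- The unnormalised expectation of `F` under the Gibbs measure. -/
def wsum (G : SimpleGraph V) (lam : ℝ) (L Γ : Set V) (F : Finset V → ℝ) : ℝ :=
  ∑ σ : Finset V, weight G lam L Γ σ * F σ

open Classical in
/-- The indicator function of `p`, with real values. -/
def ind (p : Prop) : ℝ := if p then 1 else 0

lemma ind_of {p : Prop} (h : p) : ind p = 1 := if_pos h

lemma ind_of_not {p : Prop} (h : ¬ p) : ind p = 0 := if_neg h

lemma ind_nonneg (p : Prop) : 0 ≤ ind p := by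
  unfold ind; split_ifs <;> norm_num

lemma ind_le_one (p : Prop) : ind p ≤ 1 := by
  unfold ind; split_ifs <;> norm_num

lemma ind_not (p : Prop) : ind (¬ p) = 1 - ind p := by
  by_cases h : p <;> simp [ind, h]

lemma ind_and (p q : Prop) : ind (p ∧ q) = ind p * ind q := by
  by_cases h : p <;> by_cases h' : q <;> simp [ind, h, h']

variable {G : SimpleGraph V} {lam : ℝ} {L Γ : Set V}

lemma wsum_mono (hlam : 0 < lam) {F F' : Finset V → ℝ} (h : ∀ σ, F σ ≤ F' σ) :
    wsum G lam L Γ F ≤ wsum G lam L Γ F' :=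
  Finset.sum_le_sum fun σ _ => mul_le_mul_of_nonneg_left (h σ) (weight_nonneg hlam σ)

lemma wsum_nonneg (hlam : 0 < lam) {F : Finset V → ℝ} (h : ∀ σ, 0 ≤ F σ) :
    0 ≤ wsum G lam L Γ F :=
  Finset.sum_nonneg fun σ _ => mul_nonneg (weight_nonneg hlam σ) (h σ)

lemma wsum_add (F F' : Finset V → ℝ) :
    wsum G lam L Γ (fun σ => F σ + F' σ) = wsum G lam L Γ F + wsum G lam L Γ F' := by
  simp [wsum, mul_add, Finset.sum_add_distrib]

lemma wsum_sub (F F' : Finset V → ℝ) :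
    wsum G lam L Γ (fun σ => F σ - F' σ) = wsum G lam L Γ F - wsum G lam L Γ F' := by
  simp [wsum, mul_sub, Finset.sum_sub_distrib]

/-- Sums over the state space are weighted sums over all sets of vertices. -/
lemma sum_config (F : Finset V → ℝ) :
    ∑ σ : Config G L Γ, lam ^ σ.1.card * F σ.1 = wsum G lam L Γ F := by
  classical
  rw [wsum]
  simp only [weight, ite_mul, zero_mul]
  rw [← Finset.sum_filter]
  refine (Finset.sum_subtype _ (fun σ => ?_) (fun σ : Finset V => lam ^ σ.card * F σ)).symm
  simp

lemma sum_gibbs (F : Finset V → ℝ) :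
    ∑ σ : Config G L Γ, gibbs G lam L Γ σ * F σ.1 =
      wsum G lam L Γ F / wsum G lam L Γ (fun _ => 1) := by
  rw [← sum_config, ← sum_config, Finset.sum_div]
  refine Finset.sum_congr rfl fun σ _ => ?_
  simp only [gibbs, mul_one]
  ring

variable [DecidableEq V]

lemma probOcc_eq (v : V) : probOcc G lam L Γ v =
    wsum G lam L Γ (fun σ => ind (v ∈ σ)) / wsum G lam L Γ (fun _ => 1) := by
  rw [← sum_gibbs, probOcc]
  exact Finset.sum_congr rfl fun σ _ => by by_cases h : v ∈ σ.1 <;> simp [ind, h]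

lemma probUnocc_eq (v : V) : probUnocc G lam L Γ v =
    wsum G lam L Γ (fun σ => ind (v ∉ σ)) / wsum G lam L Γ (fun _ => 1) := by
  rw [← sum_gibbs, probUnocc]
  exact Finset.sum_congr rfl fun σ _ => by by_cases h : v ∈ σ.1 <;> simp [ind, h]

/-- The vertex `v` is pivotal for the event `A` in the configuration `σ`: whether `A` occurs
depends on the state of `v`. -/
def Pivotal (A : Finset V → Prop) (v : V) (σ : Finset V) : Prop :=
  ¬ (A (insert v σ) ↔ A (σ.erase v))

/-- Removing a vertex outside `L` does not leave the state space. -/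
def eraseConfig (σ : Config G L Γ) (v : V) (hv : v ∉ L) : Config G L Γ :=
  ⟨σ.1.erase v, σ.2.1.mono (by simp), by
    refine Eq.trans ?_ σ.2.2
    ext w
    simp only [Finset.coe_erase, Set.mem_inter_iff, Set.mem_sdiff, Finset.mem_coe,
      Set.mem_singleton_iff]
    constructor
    · exact fun h => ⟨h.1.1, h.2⟩
    · exact fun h => ⟨⟨h.1, fun h' => hv (h' ▸ h.2)⟩, h.2⟩⟩

/-- Adding a vertex outside `L` without occupied neighbours does not leave the state space. -/
def insertConfig (σ : Config G L Γ) (v : V) (hv : v ∉ L) (hfree : ∀ w, G.Adj v w → w ∉ σ.1) :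
    Config G L Γ :=
  ⟨insert v σ.1, by
    rw [Finset.coe_insert, SimpleGraph.IsIndepSet, Set.pairwise_insert]
    exact ⟨σ.2.1, fun w hw _ => ⟨fun h => hfree w h hw, fun h => hfree w h.symm hw⟩⟩, by
    rw [Finset.coe_insert, Set.insert_inter_of_notMem hv]
    exact σ.2.2⟩

lemma siteUpdate_nonneg (hlam : 0 < lam) (v : V) (σ τ : Config G L Γ) :
    0 ≤ siteUpdate G lam L Γ v σ τ := by
  unfold siteUpdate
  split_ifs <;> positivity

lemma sum_siteUpdate (hlam : 0 < lam) (v : V) (σ : Config G L Γ) :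
    ∑ τ, siteUpdate G lam L Γ v σ τ = 1 := by
  unfold siteUpdate
  have hsum : ∀ (ρ : Finset V) [∀ τ : Config G L Γ, Decidable (τ.1 = ρ)],
      (∃ c : Config G L Γ, c.1 = ρ) →
      ∑ τ : Config G L Γ, (if τ.1 = ρ then (1 : ℝ) else 0) = 1 := by
    rintro ρ inst ⟨c, rfl⟩
    rw [Finset.sum_eq_single c (fun τ _ h => if_neg fun h' => h (Subtype.ext h')) (by simp),
      if_pos rfl]
  by_cases hv : v ∈ L
  · simp only [hv, if_true]; exact hsum σ.1 ⟨σ, rfl⟩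
  · by_cases hf : ∀ w, G.Adj v w → w ∉ σ.1
    · simp only [hv, if_false, if_pos hf, Finset.sum_add_distrib, ← Finset.mul_sum]
      rw [hsum (insert v σ.1) ⟨insertConfig σ v hv hf, rfl⟩,
        hsum (σ.1.erase v) ⟨eraseConfig σ v hv, rfl⟩]
      field_simp
      ring
    · simp only [hv, if_false, if_neg hf]
      exact hsum _ ⟨eraseConfig σ v hv, rfl⟩

/-- An update at `v` changes the state of `v` only, and only if `v ∉ L`. -/
lemma eq_of_siteUpdate_ne_zero {v : V} {σ τ : Config G L Γ}
    (h : siteUpdate G lam L Γ v σ τ ≠ 0) :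
    τ = σ ∨ v ∉ L ∧ (τ.1 = insert v σ.1 ∨ τ.1 = σ.1.erase v) := by
  unfold siteUpdate at h
  by_cases hv : v ∈ L
  · left
    by_contra hne
    exact h (by rw [if_pos hv, if_neg (fun h' => hne (Subtype.ext h'))])
  · refine Or.inr ⟨hv, ?_⟩
    by_contra! hne
    exact h (by simp [hv, hne.1, hne.2])

lemma siteUpdate_of_insert {v : V} {σ τ : Config G L Γ} (hv : v ∉ L) (hσ : v ∉ σ.1)
    (hτ : τ.1 = insert v σ.1) :
    siteUpdate G lam L Γ v σ τ = lam / (1 + lam) ∧ siteUpdate G lam L Γ v τ σ = 1 / (1 + lam) := by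
  have hfτ : ∀ w, G.Adj v w → w ∉ τ.1 := fun w hw hmem =>
    τ.2.1 (by rw [hτ]; simp) (Finset.mem_coe.2 hmem) hw.ne hw
  have hfσ : ∀ w, G.Adj v w → w ∉ σ.1 := fun w hw hmem =>
    hfτ w hw (by rw [hτ]; exact Finset.mem_insert_of_mem hmem)
  have h1 : τ.1 ≠ σ.1.erase v := by
    rw [hτ]; exact fun h => by have := Finset.mem_insert_self v σ.1; rw [h] at this; simp at this
  have h2 : σ.1 ≠ insert v τ.1 := fun h => hσ (by rw [h]; simp)
  have h3 : σ.1 = τ.1.erase v := by rw [hτ, Finset.erase_insert hσ]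
  constructor
  · rw [siteUpdate, if_neg hv, if_pos hfσ, if_pos hτ, if_neg h1]; ring
  · rw [siteUpdate, if_neg hv, if_pos hfτ, if_neg h2, if_pos h3]; ring

lemma siteUpdate_reversible (v : V) (σ τ : Config G L Γ) :
    lam ^ σ.1.card * siteUpdate G lam L Γ v σ τ = lam ^ τ.1.card * siteUpdate G lam L Γ v τ σ := by
  have key : ∀ σ τ : Config G L Γ, siteUpdate G lam L Γ v σ τ ≠ 0 →
      lam ^ σ.1.card * siteUpdate G lam L Γ v σ τ =
        lam ^ τ.1.card * siteUpdate G lam L Γ v τ σ := by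
    intro σ τ h
    have hins : ∀ σ τ : Config G L Γ, v ∉ L → v ∉ σ.1 → τ.1 = insert v σ.1 →
        lam ^ σ.1.card * siteUpdate G lam L Γ v σ τ =
          lam ^ τ.1.card * siteUpdate G lam L Γ v τ σ := by
      intro σ τ hv hσ hτ
      obtain ⟨h1, h2⟩ := siteUpdate_of_insert (lam := lam) hv hσ hτ
      rw [h1, h2, hτ, Finset.card_insert_of_notMem hσ]
      ring
    rcases eq_of_siteUpdate_ne_zero h with h | ⟨hv, h | h⟩
    · rw [h]
    · by_cases hσ : v ∈ σ.1
      · rw [Finset.insert_eq_of_mem hσ] at h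
        rw [Subtype.ext h]
      · exact hins σ τ hv hσ h
    · by_cases hσ : v ∈ σ.1
      · exact (hins τ σ hv (by rw [h]; simp) (by rw [h, Finset.insert_erase hσ])).symm
      · rw [Finset.erase_eq_of_notMem hσ] at h
        rw [Subtype.ext h]
  by_cases h1 : siteUpdate G lam L Γ v σ τ = 0
  · by_cases h2 : siteUpdate G lam L Γ v τ σ = 0
    · rw [h1, h2, mul_zero, mul_zero]
    · exact (key τ σ h2).symm
  · exact key σ τ h1

lemma siteUpdate_self_pos (hlam : 0 < lam) (v : V) (σ : Config G L Γ) :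
    0 < siteUpdate G lam L Γ v σ σ := by
  unfold siteUpdate
  by_cases hv : v ∈ L
  · simp [hv]
  · by_cases hσ : v ∈ σ.1
    · have hf : ∀ w, G.Adj v w → w ∉ σ.1 := fun w hw hmem =>
        σ.2.1 (Finset.mem_coe.2 hσ) (Finset.mem_coe.2 hmem) hw.ne hw
      rw [if_neg hv, if_pos hf, if_pos (Finset.insert_eq_of_mem hσ).symm]
      split_ifs <;> positivity
    · rw [if_neg hv, if_pos (Finset.erase_eq_of_notMem hσ).symm]
      split_ifs <;> positivity

lemma glauber_apply (σ τ : Config G L Γ) : glauber G lam L Γ σ τ =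
    (∑ v : V, siteUpdate G lam L Γ v σ τ) / (Fintype.card V : ℝ) := rfl

/-- Every configuration is connected to the minimal one, `Γ`, by successive removals; a function
that is invariant under the transitions is therefore constant. -/
lemma glauber_irreducible (hlam : 0 < lam) (f : Config G L Γ → ℝ)
    (hf : ∀ σ τ, 0 < glauber G lam L Γ σ τ → f σ = f τ) (σ τ : Config G L Γ) : f σ = f τ := by
  have hred : ∀ n, ∀ σ : Config G L Γ, σ.1.card = n →
      ∃ ρ : Config G L Γ, (ρ.1 : Set V) = Γ ∧ f σ = f ρ := by
    intro n
    induction n with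
    | zero =>
      intro σ hσ
      refine ⟨σ, ?_, rfl⟩
      have h := σ.2.2
      rw [Finset.card_eq_zero] at hσ
      rw [hσ] at h ⊢
      simpa using h
    | succ n ih =>
      intro σ hσ
      by_cases hsub : (σ.1 : Set V) ⊆ L
      · exact ⟨σ, (Set.inter_eq_left.2 hsub).symm.trans σ.2.2, rfl⟩
      · obtain ⟨v, hvσ, hvL⟩ := Set.not_subset.1 hsub
        obtain ⟨ρ, hρ, hfρ⟩ := ih (eraseConfig σ v hvL) (by
          simp only [eraseConfig]
          rw [Finset.card_erase_of_mem hvσ, hσ]; rfl)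
        refine ⟨ρ, hρ, ?_⟩
        rw [← hfρ]
        apply hf
        rw [glauber_apply]
        have : Nonempty V := ⟨v⟩
        refine div_pos ?_ (by exact_mod_cast Fintype.card_pos)
        refine Finset.sum_pos' (fun w _ => siteUpdate_nonneg hlam _ _ _) ⟨v, Finset.mem_univ _, ?_⟩
        rw [(siteUpdate_of_insert (lam := lam) (σ := eraseConfig σ v hvL) (τ := σ) hvL
          (by simp [eraseConfig]) (by simp [eraseConfig, Finset.insert_erase hvσ])).2]
        positivity
  obtain ⟨ρ, hρ, h1⟩ := hred _ σ rfl
  obtain ⟨ρ', hρ', h2⟩ := hred _ τ rfl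
  have : ρ = ρ' := Subtype.ext (Finset.coe_injective (hρ.trans hρ'.symm))
  rw [h1, h2, this]

/-- The spectral gap of the Glauber dynamics is positive, and an event that is neither too likely
nor too unlikely and has few pivotal vertices forces it to be small. -/
theorem spectralGap_glauber [Nonempty V] (hlam : 0 < lam) (htwo : ∃ σ τ : Config G L Γ, σ ≠ τ)
    (A : Finset V → Prop) :
    0 < spectralGap (glauber G lam L Γ) ∧
    spectralGap (glauber G lam L Γ) * (wsum G lam L Γ (fun σ => ind (A σ)) *
      wsum G lam L Γ (fun σ => ind (¬ A σ))) ≤ wsum G lam L Γ (fun _ => 1) *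
        (∑ v, wsum G lam L Γ (fun σ => ind (Pivotal A v σ))) / (Fintype.card V : ℝ) := by
  set P := glauber G lam L Γ with hP
  set π : Config G L Γ → ℝ := fun σ => lam ^ σ.1.card with hπdef
  have hn : (0 : ℝ) < Fintype.card V := by exact_mod_cast Fintype.card_pos
  have hπ : ∀ σ, 0 < π σ := fun σ => pow_pos hlam _
  have hrev : ∀ σ τ, π σ * P σ τ = π τ * P τ σ := by
    intro σ τ
    rw [hP, glauber_apply, glauber_apply, mul_div_assoc', mul_div_assoc', Finset.mul_sum,
      Finset.mul_sum]
    congr 1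
    exact Finset.sum_congr rfl fun v _ => siteUpdate_reversible v σ τ
  have hrow : ∀ σ, ∑ τ, P σ τ = 1 := by
    intro σ
    simp only [hP, glauber_apply]
    rw [← Finset.sum_div, Finset.sum_comm]
    simp only [sum_siteUpdate hlam]
    simp [hn.ne']
  have hnn : ∀ σ τ, 0 ≤ P σ τ := fun σ τ =>
    div_nonneg (Finset.sum_nonneg fun v _ => siteUpdate_nonneg hlam v σ τ) hn.le
  have hdiag : ∀ σ, 0 < P σ σ := fun σ =>
    div_pos (Finset.sum_pos (fun v _ => siteUpdate_self_pos hlam v σ) Finset.univ_nonempty) hn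
  obtain ⟨hpos, hray⟩ := spectralGap_pos_and_le hπ hrev hrow hnn hdiag
    (glauber_irreducible hlam) htwo
  refine ⟨hpos, ?_⟩
  set Z := wsum G lam L Γ (fun _ => 1) with hZ
  set a := wsum G lam L Γ (fun σ => ind (A σ)) with ha
  have hZsum : ∑ σ, π σ = Z := by
    rw [hZ, ← sum_config]; simp [hπdef]
  have hasum : ∑ σ, π σ * ind (A σ.1) = a := by rw [ha, ← sum_config]
  have hZpos : 0 < Z := by
    rw [← hZsum]
    obtain ⟨σ, -⟩ := htwo
    exact Finset.sum_pos (fun σ _ => hπ σ) ⟨σ, Finset.mem_univ _⟩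
  have hcompl : wsum G lam L Γ (fun σ => ind (¬ A σ)) = Z - a := by
    rw [hZ, ha, ← wsum_sub]; simp only [ind_not]
  rw [hcompl]
  set f : Config G L Γ → ℝ := fun σ => ind (A σ.1) - a / Z with hf
  have hf0 : ∑ σ, π σ * f σ = 0 := by
    simp only [hf, mul_sub, Finset.sum_sub_distrib, hasum, ← Finset.sum_mul, hZsum]
    field_simp; ring
  have hff : ∑ σ, π σ * (f σ * f σ) = a * (Z - a) / Z := by
    have hsq : ∀ σ, π σ * (f σ * f σ) =
        (1 - 2 * (a / Z)) * (π σ * ind (A σ.1)) + (a / Z) ^ 2 * π σ := by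
      intro σ
      have : ind (A σ.1) * ind (A σ.1) = ind (A σ.1) := by
        by_cases h : A σ.1 <;> simp [ind, h]
      simp only [hf]
      linear_combination (π σ) * this
    simp only [hsq, Finset.sum_add_distrib, ← Finset.mul_sum, hasum, hZsum]
    field_simp; ring
  have hE := sum_mul_sq_sub hrev hrow 1 (by norm_num) f
  have hbound : ∑ σ, ∑ τ, π σ * P σ τ * (f σ - 1 * f τ) ^ 2 ≤
      (∑ v, wsum G lam L Γ (fun σ => ind (Pivotal A v σ))) / (Fintype.card V : ℝ) := by
    have hpt : ∀ v (σ τ : Config G L Γ), siteUpdate G lam L Γ v σ τ * (f σ - 1 * f τ) ^ 2 ≤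
        siteUpdate G lam L Γ v σ τ * ind (Pivotal A v σ.1) := by
      intro v σ τ
      by_cases h0 : siteUpdate G lam L Γ v σ τ = 0
      · simp [h0]
      refine mul_le_mul_of_nonneg_left ?_ (siteUpdate_nonneg hlam v σ τ)
      have hfs : f σ - 1 * f τ = ind (A σ.1) - ind (A τ.1) := by simp only [hf]; ring
      rw [hfs]
      by_cases hA : A σ.1 ↔ A τ.1
      · simp only [hA, sub_self]
        exact le_trans (by norm_num) (ind_nonneg _)
      · have hpiv : Pivotal A v σ.1 := by
          have hcase : σ.1 = insert v σ.1 ∨ σ.1 = σ.1.erase v := by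
            by_cases hv : v ∈ σ.1
            · exact Or.inl (Finset.insert_eq_of_mem hv).symm
            · exact Or.inr (Finset.erase_eq_of_notMem hv).symm
          rcases eq_of_siteUpdate_ne_zero h0 with h | ⟨-, h⟩
          · exact absurd (by rw [h]) hA
          · intro hiff
            apply hA
            rcases hcase with h1 | h1 <;> rcases h with h2 | h2 <;>
              · rw [h2]
                nth_rewrite 1 [h1]
                tauto
        rw [ind_of hpiv]
        by_cases h1 : A σ.1 <;> by_cases h2 : A τ.1 <;> simp [ind, h1, h2]
    calc ∑ σ, ∑ τ, π σ * P σ τ * (f σ - 1 * f τ) ^ 2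
        = ∑ σ, ∑ τ, ∑ v, π σ * (siteUpdate G lam L Γ v σ τ * (f σ - 1 * f τ) ^ 2) /
            (Fintype.card V : ℝ) := by
          refine Finset.sum_congr rfl fun σ _ => Finset.sum_congr rfl fun τ _ => ?_
          rw [hP, glauber_apply, mul_div_assoc', div_mul_eq_mul_div, ← Finset.sum_div,
            Finset.mul_sum, Finset.sum_mul]
          congr 1
          exact Finset.sum_congr rfl fun v _ => by ring
      _ ≤ ∑ σ, ∑ τ, ∑ v, π σ * (siteUpdate G lam L Γ v σ τ * ind (Pivotal A v σ.1)) /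
            (Fintype.card V : ℝ) := by
          refine Finset.sum_le_sum fun σ _ => Finset.sum_le_sum fun τ _ =>
            Finset.sum_le_sum fun v _ => ?_
          exact div_le_div_of_nonneg_right (mul_le_mul_of_nonneg_left (hpt v σ τ) (hπ σ).le) hn.le
      _ = ∑ v, ∑ σ, ∑ τ, π σ * (siteUpdate G lam L Γ v σ τ * ind (Pivotal A v σ.1)) /
            (Fintype.card V : ℝ) := by
          rw [Finset.sum_congr rfl fun σ _ => Finset.sum_comm]
          rw [Finset.sum_comm]
      _ = _ := by
          rw [Finset.sum_div]
          refine Finset.sum_congr rfl fun v _ => ?_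
          rw [← sum_config, Finset.sum_div]
          refine Finset.sum_congr rfl fun σ _ => ?_
          rw [← Finset.sum_div, ← Finset.mul_sum, ← Finset.sum_mul, sum_siteUpdate hlam, one_mul]
  have hfin := hray f hf0
  rw [one_mul] at hE
  have hstep : spectralGap P * (a * (Z - a) / Z) ≤
      (∑ v, wsum G lam L Γ (fun σ => ind (Pivotal A v σ))) / (Fintype.card V : ℝ) := by
    rw [← hff]
    have : 0 ≤ ∑ σ, ∑ τ, π σ * P σ τ * (f σ - 1 * f τ) ^ 2 :=
      Finset.sum_nonneg fun σ _ => Finset.sum_nonneg fun τ _ =>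
        mul_nonneg (mul_nonneg (hπ σ).le (hnn σ τ)) (sq_nonneg _)
    linarith
  rw [mul_div_assoc' , div_le_iff₀ hZpos] at hstep
  calc _ ≤ _ := hstep
    _ = _ := by ring

end Glauber

/-! ### Decomposition of the tree at the root -/

section Tree

variable {b h : ℕ}

lemma eq_root_or_below (v : Vertex b (h + 1)) : v = root b (h + 1) ∨ ∃ j u, v = below j u := by
  obtain ⟨l, hl⟩ := v
  cases l with
  | nil => exact Or.inl rfl
  | cons j u => exact Or.inr ⟨j, ⟨u, Nat.le_of_succ_le_succ hl⟩, rfl⟩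

lemma below_ne_root (j : Fin b) (u : Vertex b h) : below j u ≠ root b (h + 1) := by
  intro h'
  exact List.cons_ne_nil _ _ (congrArg Subtype.val h')

@[simp] lemma below_inj {j j' : Fin b} {u u' : Vertex b h} :
    below j u = below j' u' ↔ j = j' ∧ u = u' := by
  simp [below, Subtype.ext_iff]

/-- A vertex of `T_{h+1}` is the root or a vertex of one of the `b` subtrees. -/
def vertexEquiv (b h : ℕ) : Option (Fin b × Vertex b h) ≃ Vertex b (h + 1) :=
  Equiv.ofBijective (fun o => o.elim (root b (h + 1)) fun p => below p.1 p.2) (by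
    constructor
    · rintro (_ | ⟨j, u⟩) (_ | ⟨j', u'⟩) h'
      · rfl
      · exact absurd h'.symm (below_ne_root _ _)
      · exact absurd h' (below_ne_root _ _)
      · obtain ⟨rfl, rfl⟩ := below_inj.1 h'
        rfl
    · intro v
      rcases eq_root_or_below v with rfl | ⟨j, u, rfl⟩
      · exact ⟨none, rfl⟩
      · exact ⟨some (j, u), rfl⟩)

lemma sum_vertex (f : Vertex b (h + 1) → ℝ) :
    ∑ v, f v = f (root b (h + 1)) + ∑ j, ∑ u, f (below j u) := by
  rw [← (vertexEquiv b h).sum_comp, Fintype.sum_option, Fintype.sum_prod_type]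
  rfl

lemma numVertices_zero (b : ℕ) : numVertices b 0 = 1 := by
  rw [numVertices, Fintype.card_eq_one_iff]
  refine ⟨root b 0, fun v => Subtype.ext ?_⟩
  exact List.length_eq_zero_iff.1 (Nat.le_zero.1 v.2)

lemma numVertices_succ (b h : ℕ) : numVertices b (h + 1) = b * numVertices b h + 1 := by
  rw [numVertices, ← Fintype.card_congr (vertexEquiv b h), Fintype.card_option, Fintype.card_prod,
    Fintype.card_fin, numVertices]

lemma pow_le_numVertices (b h : ℕ) : b ^ h ≤ numVertices b h := by
  induction h with
  | zero => simp [numVertices_zero]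
  | succ h ih =>
    rw [numVertices_succ, pow_succ, mul_comm]
    exact (Nat.mul_le_mul_left b ih).trans (Nat.le_succ _)

lemma numVertices_le (hb : 2 ≤ b) (h : ℕ) : numVertices b h ≤ 2 * b ^ h := by
  have : numVertices b h + 1 ≤ 2 * b ^ h := by
    induction h with
    | zero => simp [numVertices_zero]
    | succ h ih =>
      rw [numVertices_succ, pow_succ]
      nlinarith
  omega

lemma adj_below {j j' : Fin b} {u u' : Vertex b h} :
    (tree b (h + 1)).Adj (below j u) (below j' u') ↔ j = j' ∧ (tree b h).Adj u u' := by
  rw [tree, SimpleGraph.fromRel_adj, tree, SimpleGraph.fromRel_adj, ne_eq, below_inj]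
  simp only [below, List.cons_append, List.cons.injEq]
  constructor
  · rintro ⟨h1, ⟨k, rfl, h2⟩ | ⟨k, rfl, h2⟩⟩
    · exact ⟨rfl, fun h' => h1 ⟨rfl, h'⟩, Or.inl ⟨k, h2⟩⟩
    · exact ⟨rfl, fun h' => h1 ⟨rfl, h'⟩, Or.inr ⟨k, h2⟩⟩
  · rintro ⟨rfl, h1, ⟨k, h2⟩ | ⟨k, h2⟩⟩
    · exact ⟨fun h' => h1 h'.2, Or.inl ⟨k, rfl, h2⟩⟩
    · exact ⟨fun h' => h1 h'.2, Or.inr ⟨k, rfl, h2⟩⟩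

lemma adj_root {j : Fin b} {u : Vertex b h} :
    (tree b (h + 1)).Adj (root b (h + 1)) (below j u) ↔ u = root b h := by
  simp [tree, SimpleGraph.fromRel_adj, Subtype.ext_iff, root, below]

@[simp] lemma below_mem_leaves {j : Fin b} {u : Vertex b h} :
    below j u ∈ leaves b (h + 1) ↔ u ∈ leaves b h := by
  simp [leaves, below]

@[simp] lemma root_notMem_leaves : root b (h + 1) ∉ leaves b (h + 1) := by
  simp [leaves, root]

/-- The part of `σ` in the subtree of the `j`-th child of the root. -/
def sub (j : Fin b) (σ : Finset (Vertex b (h + 1))) : Finset (Vertex b h) :=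
  Finset.univ.filter fun u => below j u ∈ σ

@[simp] lemma mem_sub {j : Fin b} {σ : Finset (Vertex b (h + 1))} {u : Vertex b h} :
    u ∈ sub j σ ↔ below j u ∈ σ := by
  simp [sub]

/-- The configuration with the given parts in the subtrees, and with the root occupied if `x`. -/
def join (x : Bool) (s : Fin b → Finset (Vertex b h)) : Finset (Vertex b (h + 1)) :=
  (if x then {root b (h + 1)} else ∅) ∪ Finset.univ.biUnion fun j => (s j).image (below j)

@[simp] lemma below_mem_join {x : Bool} {s : Fin b → Finset (Vertex b h)} {j : Fin b}
    {u : Vertex b h} : below j u ∈ join x s ↔ u ∈ s j := by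
  have : below j u ∉ (if x then {root b (h + 1)} else ∅ : Finset (Vertex b (h + 1))) := by
    cases x <;> simp [below_ne_root]
  simp only [join, Finset.mem_union, this, false_or, Finset.mem_biUnion, Finset.mem_univ,
    true_and, Finset.mem_image, below_inj]
  constructor
  · rintro ⟨i, w, hw, rfl, rfl⟩; exact hw
  · exact fun hu => ⟨j, u, hu, rfl, rfl⟩

@[simp] lemma root_mem_join {x : Bool} {s : Fin b → Finset (Vertex b h)} :
    root b (h + 1) ∈ join x s ↔ x = true := by
  cases x <;> simp [join, below_ne_root]

@[simp] lemma sub_join (x : Bool) (s : Fin b → Finset (Vertex b h)) (j : Fin b) :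
    sub j (join x s) = s j := by
  ext u; simp

lemma join_sub (σ : Finset (Vertex b (h + 1))) :
    join (decide (root b (h + 1) ∈ σ)) (fun j => sub j σ) = σ := by
  ext v
  rcases eq_root_or_below v with rfl | ⟨j, u, rfl⟩ <;> simp

/-- A configuration on `T_{h+1}` consists of the state of the root and of configurations on the
subtrees. -/
def configEquiv (b h : ℕ) :
    Bool × (Fin b → Finset (Vertex b h)) ≃ Finset (Vertex b (h + 1)) where
  toFun p := join p.1 p.2
  invFun σ := (decide (root b (h + 1) ∈ σ), fun j => sub j σ)
  left_inv p := by
    refine Prod.ext ?_ (funext fun j => sub_join _ _ _)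
    simp
  right_inv σ := join_sub σ

lemma card_join (x : Bool) (s : Fin b → Finset (Vertex b h)) :
    (join x s).card = (if x then 1 else 0) + ∑ j, (s j).card := by
  rw [join, Finset.card_union_of_disjoint, Finset.card_biUnion]
  · congr 1
    · cases x <;> simp
    · exact Finset.sum_congr rfl fun j _ =>
        Finset.card_image_of_injective _ fun u u' h' => (below_inj.1 h').2
  · intro i _ j _ hij
    rw [Function.onFun, Finset.disjoint_left]
    intro v hv hv'
    obtain ⟨u, -, rfl⟩ := Finset.mem_image.1 hv
    obtain ⟨u', -, h'⟩ := Finset.mem_image.1 hv'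
    exact hij (below_inj.1 h').1.symm
  · rw [Finset.disjoint_left]
    intro v hv hv'
    obtain ⟨j, -, hj⟩ := Finset.mem_biUnion.1 hv'
    obtain ⟨u, -, rfl⟩ := Finset.mem_image.1 hj
    cases x <;> simp [below_ne_root] at hv

lemma isIndepSet_join (x : Bool) (s : Fin b → Finset (Vertex b h)) :
    (tree b (h + 1)).IsIndepSet (join x s : Set (Vertex b (h + 1))) ↔
      (x = true → ∀ j, root b h ∉ s j) ∧ ∀ j, (tree b h).IsIndepSet (s j : Set (Vertex b h)) := by
  constructor
  · intro hind
    refine ⟨fun hx j hj => ?_, fun j u hu u' hu' hne hadj => ?_⟩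
    · exact hind (Finset.mem_coe.2 (root_mem_join.2 hx)) (Finset.mem_coe.2 (below_mem_join.2 hj))
        (below_ne_root _ _).symm (adj_root.2 rfl)
    · exact hind (Finset.mem_coe.2 (below_mem_join.2 hu)) (Finset.mem_coe.2 (below_mem_join.2 hu'))
        (fun h' => hne (below_inj.1 h').2) (adj_below.2 ⟨rfl, hadj⟩)
  · rintro ⟨h1, h2⟩ v hv w hw hne hadj
    rw [Finset.mem_coe] at hv hw
    rcases eq_root_or_below v with rfl | ⟨j, u, rfl⟩ <;>
      rcases eq_root_or_below w with rfl | ⟨j', u', rfl⟩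
    · exact hne rfl
    · rw [adj_root.1 hadj] at hw
      exact h1 (root_mem_join.1 hv) j' (below_mem_join.1 hw)
    · rw [adj_root.1 hadj.symm] at hv
      exact h1 (root_mem_join.1 hw) j (below_mem_join.1 hv)
    · obtain ⟨rfl, hadj'⟩ := adj_below.1 hadj
      exact h2 j (Finset.mem_coe.2 (below_mem_join.1 hv)) (Finset.mem_coe.2 (below_mem_join.1 hw))
        hadj'.ne hadj'

lemma join_inter_leaves (x : Bool) (s : Fin b → Finset (Vertex b h)) {Γ : Set (Vertex b (h + 1))}
    (hΓ : Γ ⊆ leaves b (h + 1)) :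
    (join x s : Set (Vertex b (h + 1))) ∩ leaves b (h + 1) = Γ ↔
      ∀ j, (s j : Set (Vertex b h)) ∩ leaves b h = below j ⁻¹' Γ := by
  constructor
  · intro h' j
    ext u
    rw [← h']
    simp
  · intro h'
    ext v
    rcases eq_root_or_below v with rfl | ⟨j, u, rfl⟩
    · simp only [Set.mem_inter_iff, root_notMem_leaves, and_false, false_iff]
      exact fun hr => root_notMem_leaves (hΓ hr)
    · have := Set.ext_iff.1 (h' j) u
      simpa using this

variable {lam : ℝ}

lemma weight_join (x : Bool) (s : Fin b → Finset (Vertex b h)) {Γ : Set (Vertex b (h + 1))}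
    (hΓ : Γ ⊆ leaves b (h + 1)) :
    weight (tree b (h + 1)) lam (leaves b (h + 1)) Γ (join x s) =
      (if x then lam * ∏ j, ind (root b h ∉ s j) else 1) *
        ∏ j, weight (tree b h) lam (leaves b h) (below j ⁻¹' Γ) (s j) := by
  have hiff : (tree b (h + 1)).IsIndepSet (join x s : Set (Vertex b (h + 1))) ∧
      (join x s : Set (Vertex b (h + 1))) ∩ leaves b (h + 1) = Γ ↔
      (x = true → ∀ j, root b h ∉ s j) ∧ ∀ j, (tree b h).IsIndepSet (s j : Set (Vertex b h)) ∧
        (s j : Set (Vertex b h)) ∩ leaves b h = below j ⁻¹' Γ := by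
    rw [isIndepSet_join, join_inter_leaves x s hΓ, forall_and, and_assoc]
  by_cases hall : ∀ j, (tree b h).IsIndepSet (s j : Set (Vertex b h)) ∧
      (s j : Set (Vertex b h)) ∩ leaves b h = below j ⁻¹' Γ
  · have hw : ∀ j, weight (tree b h) lam (leaves b h) (below j ⁻¹' Γ) (s j) =
        lam ^ (s j).card := fun j => weight_of (hall j)
    simp only [hw, Finset.prod_pow_eq_pow_sum]
    cases x
    · rw [weight_of (hiff.2 ⟨by simp, hall⟩), card_join]
      simp
    · by_cases hr : ∀ j, root b h ∉ s j
      · rw [weight_of (hiff.2 ⟨fun _ => hr, hall⟩), card_join]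
        simp [ind, hr, pow_add]
      · rw [weight_of_not fun h' => hr ((hiff.1 h').1 rfl)]
        obtain ⟨j, hj⟩ := not_forall.1 hr
        rw [if_pos rfl, Finset.prod_eq_zero (Finset.mem_univ j) (ind_of_not hj)]
        simp
  · obtain ⟨j, hj⟩ := not_forall.1 hall
    have hw : ∏ j, weight (tree b h) lam (leaves b h) (below j ⁻¹' Γ) (s j) = 0 :=
      Finset.prod_eq_zero (Finset.mem_univ j) (weight_of_not hj)
    rw [hw, mul_zero, weight_of_not]
    exact fun h' => hj ((hiff.1 h').2 j)

/-- The part of the weighted sum of `F` over the configurations with unoccupied root. -/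
def W0 (b h : ℕ) (lam : ℝ) (Γ : Set (Vertex b h)) (F : Finset (Vertex b h) → ℝ) : ℝ :=
  wsum (tree b h) lam (leaves b h) Γ fun σ => ind (root b h ∉ σ) * F σ

/-- The part of the weighted sum of `F` over the configurations with occupied root. -/
def W1 (b h : ℕ) (lam : ℝ) (Γ : Set (Vertex b h)) (F : Finset (Vertex b h) → ℝ) : ℝ :=
  wsum (tree b h) lam (leaves b h) Γ fun σ => ind (root b h ∈ σ) * F σ

lemma W0_add_W1 (Γ : Set (Vertex b h)) (F : Finset (Vertex b h) → ℝ) :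
    W0 b h lam Γ F + W1 b h lam Γ F = wsum (tree b h) lam (leaves b h) Γ F := by
  rw [W0, W1, ← wsum_add]
  congr 1
  ext σ
  rw [ind_not]; ring

/-- Given an occupied root, the subtrees are independent and conditioned on unoccupied roots. -/
lemma W1_prod {Γ : Set (Vertex b (h + 1))} (hΓ : Γ ⊆ leaves b (h + 1))
    (F : Fin b → Finset (Vertex b h) → ℝ) :
    W1 b (h + 1) lam Γ (fun σ => ∏ j, F j (sub j σ)) =
      lam * ∏ j, W0 b h lam (below j ⁻¹' Γ) (F j) := by
  rw [W1, wsum, ← (configEquiv b h).sum_comp, Fintype.sum_prod_type, Fintype.sum_bool]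
  simp only [configEquiv, Equiv.coe_fn_mk, weight_join _ _ hΓ, sub_join, root_mem_join, W0, wsum]
  rw [Finset.prod_univ_sum, Fintype.piFinset_univ, Finset.mul_sum]
  simp only [if_true, ind_of, ind_of_not, Bool.false_eq_true, not_false_eq_true, zero_mul,
    mul_zero, Finset.sum_const_zero, add_zero, one_mul]
  refine Finset.sum_congr rfl fun s _ => ?_
  simp only [Finset.prod_mul_distrib]
  ring

/-- Given an unoccupied root, the subtrees are independent. -/
lemma W0_prod {Γ : Set (Vertex b (h + 1))} (hΓ : Γ ⊆ leaves b (h + 1))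
    (F : Fin b → Finset (Vertex b h) → ℝ) :
    W0 b (h + 1) lam Γ (fun σ => ∏ j, F j (sub j σ)) =
      ∏ j, (W0 b h lam (below j ⁻¹' Γ) (F j) + W1 b h lam (below j ⁻¹' Γ) (F j)) := by
  rw [W0, wsum, ← (configEquiv b h).sum_comp, Fintype.sum_prod_type, Fintype.sum_bool]
  simp only [configEquiv, Equiv.coe_fn_mk, weight_join _ _ hΓ, sub_join, root_mem_join,
    W0_add_W1, wsum]
  rw [Finset.prod_univ_sum, Fintype.piFinset_univ]
  simp only [ind_of, ind_of_not, Bool.false_eq_true, not_false_eq_true, zero_mul,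
    mul_zero, Finset.sum_const_zero, zero_add, one_mul, not_true_eq_false, if_false]
  refine Finset.sum_congr rfl fun s _ => ?_
  rw [Finset.prod_mul_distrib]

lemma preimage_below_subset {Γ : Set (Vertex b (h + 1))} (hΓ : Γ ⊆ leaves b (h + 1)) (j : Fin b) :
    below j ⁻¹' Γ ⊆ leaves b h := fun _ hu => below_mem_leaves.1 (hΓ hu)

end Tree

/-! ### Partition functions and `Q`-values -/

section Weights

variable {b h : ℕ} {lam : ℝ} {Γ : Set (Vertex b h)}

lemma W0_nonneg (hlam : 0 < lam) {F : Finset (Vertex b h) → ℝ} (hF : ∀ σ, 0 ≤ F σ) :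
    0 ≤ W0 b h lam Γ F :=
  wsum_nonneg hlam fun σ => mul_nonneg (ind_nonneg _) (hF σ)

lemma W1_nonneg (hlam : 0 < lam) {F : Finset (Vertex b h) → ℝ} (hF : ∀ σ, 0 ≤ F σ) :
    0 ≤ W1 b h lam Γ F :=
  wsum_nonneg hlam fun σ => mul_nonneg (ind_nonneg _) (hF σ)

lemma W0_mono (hlam : 0 < lam) {F F' : Finset (Vertex b h) → ℝ} (hF : ∀ σ, F σ ≤ F' σ) :
    W0 b h lam Γ F ≤ W0 b h lam Γ F' :=
  wsum_mono hlam fun σ => mul_le_mul_of_nonneg_left (hF σ) (ind_nonneg _)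

lemma W0_not (A : Finset (Vertex b h) → Prop) :
    W0 b h lam Γ (fun σ => ind (¬ A σ)) =
      W0 b h lam Γ (fun _ => 1) - W0 b h lam Γ (fun σ => ind (A σ)) := by
  rw [W0, W0, W0, ← wsum_sub]
  congr 1; ext σ
  rw [ind_not (A σ)]; ring

lemma W1_not (A : Finset (Vertex b h) → Prop) :
    W1 b h lam Γ (fun σ => ind (¬ A σ)) =
      W1 b h lam Γ (fun _ => 1) - W1 b h lam Γ (fun σ => ind (A σ)) := by
  rw [W1, W1, W1, ← wsum_sub]
  congr 1; ext σ
  rw [ind_not (A σ)]; ring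

lemma length_ne_of_adj {v w : Vertex b h} (hvw : (tree b h).Adj v w) :
    v.1.length ≠ w.1.length := by
  rw [tree, SimpleGraph.fromRel_adj] at hvw
  rcases hvw.2 with ⟨j, hj⟩ | ⟨j, hj⟩ <;>
    · rw [hj, List.length_append, List.length_singleton]; omega

lemma wsum_one_pos (hlam : 0 < lam) (hΓ : Γ ⊆ leaves b h) :
    0 < wsum (tree b h) lam (leaves b h) Γ (fun _ => 1) := by
  classical
  refine Finset.sum_pos' (fun σ _ => mul_nonneg (weight_nonneg hlam σ) zero_le_one)
    ⟨(Set.toFinite Γ).toFinset, Finset.mem_univ _, ?_⟩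
  rw [weight_of, mul_one]
  · positivity
  · rw [Set.Finite.coe_toFinset]
    refine ⟨fun v hv w hw _ hadj => length_ne_of_adj hadj ?_, Set.inter_eq_left.2 hΓ⟩
    rw [hΓ hv, hΓ hw]

lemma W0_one {Γ : Set (Vertex b (h + 1))} (hΓ : Γ ⊆ leaves b (h + 1)) :
    W0 b (h + 1) lam Γ (fun _ => 1) =
      ∏ j, (W0 b h lam (below j ⁻¹' Γ) (fun _ => 1) + W1 b h lam (below j ⁻¹' Γ) (fun _ => 1)) := by
  rw [← W0_prod hΓ]; simp

lemma W1_one {Γ : Set (Vertex b (h + 1))} (hΓ : Γ ⊆ leaves b (h + 1)) :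
    W1 b (h + 1) lam Γ (fun _ => 1) =
      lam * ∏ j, W0 b h lam (below j ⁻¹' Γ) (fun _ => 1) := by
  rw [← W1_prod hΓ]; simp

lemma W0_one_pos {Γ : Set (Vertex b (h + 1))} (hlam : 0 < lam) (hΓ : Γ ⊆ leaves b (h + 1)) :
    0 < W0 b (h + 1) lam Γ (fun _ => 1) := by
  rw [W0_one hΓ]
  refine Finset.prod_pos fun j _ => ?_
  rw [W0_add_W1]
  exact wsum_one_pos hlam (preimage_below_subset hΓ j)

lemma W1_one_pos {Γ : Set (Vertex b (h + 1 + 1))} (hlam : 0 < lam)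
    (hΓ : Γ ⊆ leaves b (h + 1 + 1)) : 0 < W1 b (h + 1 + 1) lam Γ (fun _ => 1) := by
  rw [W1_one hΓ]
  exact mul_pos hlam (Finset.prod_pos fun j _ => W0_one_pos hlam (preimage_below_subset hΓ j))

/-- On a tree of height at least two there are at least two configurations, as the root is free to
be occupied or not. -/
lemma exists_config_ne {Γ : Set (Vertex b (h + 1 + 1))} (hΓ : Γ ⊆ leaves b (h + 1 + 1)) :
    ∃ σ τ : Config (tree b (h + 1 + 1)) (leaves b (h + 1 + 1)) Γ, σ ≠ τ := by
  have h0 := (W0_one_pos one_pos hΓ).ne'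
  have h1 := (W1_one_pos one_pos hΓ).ne'
  obtain ⟨σ, -, hσ⟩ := Finset.exists_ne_zero_of_sum_ne_zero h0
  obtain ⟨τ, -, hτ⟩ := Finset.exists_ne_zero_of_sum_ne_zero h1
  have hmem : ∀ (ρ : Finset (Vertex b (h + 1 + 1))) (p : Prop),
      weight (tree b (h + 1 + 1)) 1 (leaves b (h + 1 + 1)) Γ ρ * (ind p * 1) ≠ 0 →
      ((tree b (h + 1 + 1)).IsIndepSet (ρ : Set (Vertex b (h + 1 + 1))) ∧
        (ρ : Set (Vertex b (h + 1 + 1))) ∩ leaves b (h + 1 + 1) = Γ) ∧ p := by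
    intro ρ p hne
    constructor
    · by_contra hcon
      exact hne (by rw [weight_of_not hcon, zero_mul])
    · by_contra hcon
      exact hne (by rw [ind_of_not hcon, zero_mul, mul_zero])
  obtain ⟨hσ1, hσ2⟩ := hmem _ _ hσ
  obtain ⟨hτ1, hτ2⟩ := hmem _ _ hτ
  refine ⟨⟨σ, hσ1⟩, ⟨τ, hτ1⟩, fun heq => hσ2 ?_⟩
  rw [Subtype.mk.injEq] at heq
  rwa [heq]

variable {ω : ℝ}

lemma activity_pos (hω : 0 < ω) : 0 < activity b ω := by unfold activity; positivity

lemma W1_eq_qValue_mul {Γ : Set (Vertex b (h + 1))} (hω : 0 < ω) (hΓ : Γ ⊆ leaves b (h + 1)) :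
    W1 b (h + 1) (activity b ω) Γ (fun _ => 1) =
      ω * qValue b (h + 1) ω Γ * W0 b (h + 1) (activity b ω) Γ (fun _ => 1) := by
  have hlam := activity_pos (b := b) hω
  have hZ := (wsum_one_pos hlam hΓ).ne'
  have hW := (W0_one_pos hlam hΓ).ne'
  have h0 : W0 b (h + 1) (activity b ω) Γ (fun _ => 1) =
      wsum (tree b (h + 1)) (activity b ω) (leaves b (h + 1)) Γ
        (fun σ => ind (root b (h + 1) ∉ σ)) := by simp [W0]
  have h1 : W1 b (h + 1) (activity b ω) Γ (fun _ => 1) =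
      wsum (tree b (h + 1)) (activity b ω) (leaves b (h + 1)) Γ
        (fun σ => ind (root b (h + 1) ∈ σ)) := by simp [W1]
  rw [qValue, probOcc_eq, probUnocc_eq, ← h0, ← h1]
  field_simp

lemma qValue_nonneg {Γ : Set (Vertex b (h + 1))} (hω : 0 < ω) (hΓ : Γ ⊆ leaves b (h + 1)) :
    0 ≤ qValue b (h + 1) ω Γ := by
  have hlam := activity_pos (b := b) hω
  have h1 : 0 ≤ W1 b (h + 1) (activity b ω) Γ (fun _ => 1) :=
    W1_nonneg hlam fun _ => zero_le_one
  rw [W1_eq_qValue_mul hω hΓ, mul_assoc] at h1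
  have := nonneg_of_mul_nonneg_right h1 hω
  exact nonneg_of_mul_nonneg_left this (W0_one_pos hlam hΓ)

/-- The recursion of the `Q`-values along the tree. -/
lemma qValue_succ {Γ : Set (Vertex b (h + 1 + 1))} (hω : 0 < ω)
    (hΓ : Γ ⊆ leaves b (h + 1 + 1)) :
    qValue b (h + 1 + 1) ω Γ =
      (1 + ω) ^ b / ∏ j, (1 + ω * qValue b (h + 1) ω (below j ⁻¹' Γ)) := by
  have hlam := activity_pos (b := b) hω
  have hW := W1_eq_qValue_mul hω hΓ
  rw [W1_one hΓ, W0_one hΓ] at hW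
  have hj : ∀ j : Fin b, W0 b (h + 1) (activity b ω) (below j ⁻¹' Γ) (fun _ => 1) +
      W1 b (h + 1) (activity b ω) (below j ⁻¹' Γ) (fun _ => 1) =
      (1 + ω * qValue b (h + 1) ω (below j ⁻¹' Γ)) *
        W0 b (h + 1) (activity b ω) (below j ⁻¹' Γ) (fun _ => 1) := by
    intro j
    rw [W1_eq_qValue_mul hω (preimage_below_subset hΓ j)]; ring
  simp only [hj, Finset.prod_mul_distrib] at hW
  have hpos : 0 < ∏ j : Fin b, W0 b (h + 1) (activity b ω) (below j ⁻¹' Γ) (fun _ => 1) :=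
    Finset.prod_pos fun j _ => W0_one_pos hlam (preimage_below_subset hΓ j)
  have hpos' : 0 < ∏ j : Fin b, (1 + ω * qValue b (h + 1) ω (below j ⁻¹' Γ)) :=
    Finset.prod_pos fun j _ => by
      have := qValue_nonneg hω (preimage_below_subset hΓ j)
      positivity
  rw [eq_div_iff hpos'.ne']
  rw [activity, ← mul_assoc] at hW
  have := mul_right_cancel₀ hpos.ne' hW
  have h2 : ω * (1 + ω) ^ b = ω * (qValue b (h + 1 + 1) ω Γ *
      ∏ j : Fin b, (1 + ω * qValue b (h + 1) ω (below j ⁻¹' Γ))) := by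
    rw [this]; ring
  exact (mul_left_cancel₀ hω.ne' h2).symm

/-- On `T_1` the subtrees of the root are single leaves. -/
lemma qValue_one_eq {Γ : Set (Vertex b (0 + 1))} (hω : 0 < ω) (hΓ : Γ ⊆ leaves b (0 + 1)) :
    qValue b (0 + 1) ω Γ = (1 + ω) ^ b *
      (∏ j, W0 b 0 (activity b ω) (below j ⁻¹' Γ) (fun _ => 1)) /
        W0 b (0 + 1) (activity b ω) Γ (fun _ => 1) := by
  have hW := W1_eq_qValue_mul hω hΓ
  have hpos := W0_one_pos (activity_pos (b := b) hω) hΓ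
  rw [W1_one hΓ] at hW
  rw [eq_div_iff hpos.ne']
  refine mul_left_cancel₀ hω.ne' ?_
  rw [← mul_assoc, ← mul_assoc, ← hW, activity]

end Weights

/-! ### Reconstruction of the root -/

section Reconstruction

variable {b m h : ℕ}

/-- The reconstruction of the state of the root from the states of the vertices at height `m`:
a vertex at greater height is taken to be occupied if all of its children are taken to be
unoccupied. On trees of height at most `m` the state of the root itself is read off. -/
def recon (b m : ℕ) : (h : ℕ) → Finset (Vertex b h) → Prop
  | 0, σ => root b 0 ∈ σ
  | h + 1, σ => if h < m then root b (h + 1) ∈ σ else ∀ j, ¬ recon b m h (sub j σ)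

lemma recon_self (σ : Finset (Vertex b m)) : recon b m m σ ↔ root b m ∈ σ := by
  cases m with
  | zero => rfl
  | succ m => rw [recon, if_pos (Nat.lt_succ_self m)]

lemma recon_succ (hm : m ≤ h) (σ : Finset (Vertex b (h + 1))) :
    recon b m (h + 1) σ ↔ ∀ j, ¬ recon b m h (sub j σ) := by
  rw [recon, if_neg (Nat.not_lt.2 hm)]

lemma ind_recon_succ (hm : m ≤ h) (σ : Finset (Vertex b (h + 1))) :
    ind (recon b m (h + 1) σ) = ∏ j, ind (¬ recon b m h (sub j σ)) := by
  rw [recon_succ hm]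
  by_cases hall : ∀ j, ¬ recon b m h (sub j σ)
  · rw [ind_of hall, Finset.prod_eq_one fun j _ => ind_of (hall j)]
  · obtain ⟨j, hj⟩ := not_forall.1 hall
    rw [ind_of_not hall, Finset.prod_eq_zero (Finset.mem_univ j) (ind_of_not hj)]

lemma pivotal_recon_self (v : Vertex b m) (σ : Finset (Vertex b m)) :
    Pivotal (recon b m m) v σ ↔ v = root b m := by
  rw [Pivotal, recon_self, recon_self]
  by_cases hv : v = root b m
  · simp [hv]
  · simp [hv, Ne.symm hv]

lemma sub_insert_root (j : Fin b) (σ : Finset (Vertex b (h + 1))) :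
    sub j (insert (root b (h + 1)) σ) = sub j σ := by
  ext u; simp [below_ne_root]

lemma sub_erase_root (j : Fin b) (σ : Finset (Vertex b (h + 1))) :
    sub j (σ.erase (root b (h + 1))) = sub j σ := by
  ext u; simp [below_ne_root]

lemma sub_insert_below (i j : Fin b) (u : Vertex b h) (σ : Finset (Vertex b (h + 1))) :
    sub i (insert (below j u) σ) = if i = j then insert u (sub i σ) else sub i σ := by
  ext w
  split_ifs with hij <;> simp [hij]

lemma sub_erase_below (i j : Fin b) (u : Vertex b h) (σ : Finset (Vertex b (h + 1))) :
    sub i (σ.erase (below j u)) = if i = j then (sub i σ).erase u else sub i σ := by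
  ext w
  split_ifs with hij <;> simp [hij]

lemma not_pivotal_recon_root (hm : m ≤ h) (σ : Finset (Vertex b (h + 1))) :
    ¬ Pivotal (recon b m (h + 1)) (root b (h + 1)) σ := by
  rw [Pivotal, not_not, recon_succ hm, recon_succ hm]
  simp only [sub_insert_root, sub_erase_root]

/-- A vertex of the `j`-th subtree is pivotal if it is so in its subtree and the other children of
the root are taken to be unoccupied. -/
lemma pivotal_recon_below (hm : m ≤ h) (j : Fin b) (u : Vertex b h)
    (σ : Finset (Vertex b (h + 1))) :
    Pivotal (recon b m (h + 1)) (below j u) σ ↔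
      Pivotal (recon b m h) u (sub j σ) ∧ ∀ i, i ≠ j → ¬ recon b m h (sub i σ) := by
  have key : ∀ τ : Finset (Vertex b h),
      (∀ i, ¬ recon b m h (if i = j then τ else sub i σ)) ↔
        ¬ recon b m h τ ∧ ∀ i, i ≠ j → ¬ recon b m h (sub i σ) := by
    intro τ
    constructor
    · intro hall
      refine ⟨by simpa using hall j, fun i hi => by simpa [hi] using hall i⟩
    · rintro ⟨h1, h2⟩ i
      by_cases hi : i = j
      · simpa [hi] using h1
      · simpa [hi] using h2 i hi
  have e1 : ∀ i, (if i = j then insert u (sub i σ) else sub i σ) =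
      if i = j then insert u (sub j σ) else sub i σ := fun i => by
    by_cases hi : i = j <;> simp [hi]
  have e2 : ∀ i, (if i = j then (sub i σ).erase u else sub i σ) =
      if i = j then (sub j σ).erase u else sub i σ := fun i => by
    by_cases hi : i = j <;> simp [hi]
  rw [Pivotal, Pivotal, recon_succ hm, recon_succ hm]
  simp only [sub_insert_below, sub_erase_below, e1, e2, key]
  tauto

lemma ind_pivotal_below (hm : m ≤ h) (j : Fin b) (u : Vertex b h)
    (σ : Finset (Vertex b (h + 1))) :
    ind (Pivotal (recon b m (h + 1)) (below j u) σ) =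
      ∏ i, (fun τ => if i = j then ind (Pivotal (recon b m h) u τ) else ind (¬ recon b m h τ))
        (sub i σ) := by
  rw [pivotal_recon_below hm, ind_and, ← Finset.mul_prod_erase _ _ (Finset.mem_univ j)]
  simp only [if_true]
  congr 1
  by_cases hall : ∀ i, i ≠ j → ¬ recon b m h (sub i σ)
  · rw [ind_of hall, Finset.prod_eq_one]
    intro i hi
    rw [if_neg (Finset.ne_of_mem_erase hi), ind_of (hall i (Finset.ne_of_mem_erase hi))]
  · obtain ⟨i, hi⟩ := not_forall.1 hall
    rw [Classical.not_imp] at hi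
    rw [ind_of_not hall, Finset.prod_eq_zero (Finset.mem_erase.2 ⟨hi.1, Finset.mem_univ i⟩)]
    rw [if_neg hi.1, ind_of_not hi.2]

/-- The quality of the reconstruction after `k` levels: it errs with probability at most `a` if the
root is unoccupied and at most `b * a` if it is occupied, and the expected number of pivotal
vertices is at most `φ ^ k` and `b * φ ^ (k - 1)`, respectively. -/
structure ReconBound (b m h : ℕ) (lam a φ : ℝ) (k : ℕ) (Γ : Set (Vertex b h)) : Prop where
  err0 : W0 b h lam Γ (fun σ => ind (recon b m h σ)) ≤ a * W0 b h lam Γ (fun _ => 1)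
  err1 : W1 b h lam Γ (fun σ => ind (¬ recon b m h σ)) ≤ b * a * W1 b h lam Γ (fun _ => 1)
  piv0 : ∑ v, W0 b h lam Γ (fun σ => ind (Pivotal (recon b m h) v σ)) ≤
    φ ^ k * W0 b h lam Γ (fun _ => 1)
  piv1 : ∑ v, W1 b h lam Γ (fun σ => ind (Pivotal (recon b m h) v σ)) ≤
    b * φ ^ k / φ * W1 b h lam Γ (fun _ => 1)

lemma reconBound_self {lam a φ : ℝ} (hlam : 0 < lam) (ha : 0 ≤ a) (hφ : 0 < φ) (hφb : φ ≤ b)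
    (Γ : Set (Vertex b m)) : ReconBound b m m lam a φ 0 Γ := by
  have h0 : 0 ≤ W0 b m lam Γ (fun _ => 1) := W0_nonneg hlam fun _ => zero_le_one
  have h1 : 0 ≤ W1 b m lam Γ (fun _ => 1) := W1_nonneg hlam fun _ => zero_le_one
  have hsum : ∀ F : (Finset (Vertex b m) → ℝ) → ℝ, F (fun _ => 0) = 0 →
      ∑ v, F (fun σ => ind (Pivotal (recon b m m) v σ)) = F (fun _ => 1) := by
    intro F hF
    simp only [pivotal_recon_self]
    rw [Finset.sum_eq_single (root b m)]
    · simp only [ind_of]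
    · intro v _ hv
      simp only [ind_of_not hv, hF]
    · simp
  refine ⟨?_, ?_, ?_, ?_⟩
  · have : W0 b m lam Γ (fun σ => ind (recon b m m σ)) = 0 := by
      simp only [recon_self, W0, wsum, ← ind_and, not_and_self_iff]
      simp [ind]
    rw [this]; positivity
  · have : W1 b m lam Γ (fun σ => ind (¬ recon b m m σ)) = 0 := by
      simp only [recon_self, W1, wsum, ← ind_and, and_not_self_iff]
      simp [ind]
    rw [this]; positivity
  · rw [hsum (W0 b m lam Γ) (by simp [W0, wsum])]; simp
  · rw [hsum (W1 b m lam Γ) (by simp [W1, wsum])]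
    refine le_mul_of_one_le_left h1 ?_
    rw [pow_zero, mul_one, le_div_iff₀ hφ, one_mul]
    exact hφb

/-- One level of the recursion for the quality of the reconstruction, when all `Q`-values are at
most `q`. -/
lemma ReconBound.succ {ω a φ q : ℝ} {k : ℕ} (hω : 0 < ω) (ha : 0 ≤ a) (ha1 : a ≤ 1) (hφ : 0 < φ)
    (hm : m ≤ h + 1) {Γ : Set (Vertex b (h + 1 + 1))} (hΓ : Γ ⊆ leaves b (h + 1 + 1))
    (hq : qValue b (h + 1 + 1) ω Γ ≤ q)
    (hqj : ∀ j, qValue b (h + 1) ω (below j ⁻¹' Γ) ≤ q)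
    (hrec : ∀ j, ReconBound b m (h + 1) (activity b ω) a φ k (below j ⁻¹' Γ))
    (hstep0 : q * (1 + b * a * (ω * q)) ^ b / (1 + ω) ^ b ≤ a)
    (hstep1 : b * (φ + b * ω * q) * (q * (1 + b * a * (ω * q)) ^ b / (1 + ω) ^ b) ≤ φ ^ 2) :
    ReconBound b m (h + 1 + 1) (activity b ω) a φ (k + 1) Γ := by
  set lam := activity b ω with hlamdef
  have hlam : 0 < lam := activity_pos hω
  set w : Fin b → ℝ := fun j => W0 b (h + 1) lam (below j ⁻¹' Γ) (fun _ => 1) with hw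
  have hw0 : ∀ j, 0 < w j := fun j => W0_one_pos hlam (preimage_below_subset hΓ j)
  have hq0 : 0 ≤ q := (qValue_nonneg hω hΓ).trans hq
  have hω1 : (0 : ℝ) < (1 + ω) ^ b := by positivity
  have hW1 : ∀ j, W1 b (h + 1) lam (below j ⁻¹' Γ) (fun _ => 1) ≤ ω * q * w j := by
    intro j
    rw [W1_eq_qValue_mul hω (preimage_below_subset hΓ j)]
    exact mul_le_mul_of_nonneg_right (mul_le_mul_of_nonneg_left (hqj j) hω.le) (hw0 j).le
  set t : ℝ := 1 + b * a * (ω * q) with ht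
  have ht1 : 1 ≤ t := by
    have : 0 ≤ b * a * (ω * q) := by positivity
    linarith
  -- the weight of all children being unoccupied, relative to the weight of an unoccupied root
  have hprod : ∏ j, w j ≤ q / (1 + ω) ^ b * W0 b (h + 1 + 1) lam Γ (fun _ => 1) := by
    have h1 := W1_eq_qValue_mul hω hΓ
    rw [W1_one hΓ] at h1
    have h2 : (1 + ω) ^ b * ∏ j, w j =
        qValue b (h + 1 + 1) ω Γ * W0 b (h + 1 + 1) lam Γ (fun _ => 1) := by
      refine mul_left_cancel₀ hω.ne' ?_
      rw [← mul_assoc, ← mul_assoc, ← h1]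
      rfl
    rw [div_mul_eq_mul_div, le_div_iff₀ hω1, mul_comm, h2]
    exact mul_le_mul_of_nonneg_right hq (W0_one_pos hlam hΓ).le
  have hnot : ∀ j, W0 b (h + 1) lam (below j ⁻¹' Γ) (fun σ => ind (¬ recon b m (h + 1) σ)) +
      W1 b (h + 1) lam (below j ⁻¹' Γ) (fun σ => ind (¬ recon b m (h + 1) σ)) ≤ w j * t := by
    intro j
    have h0 : W0 b (h + 1) lam (below j ⁻¹' Γ) (fun σ => ind (¬ recon b m (h + 1) σ)) ≤ w j :=
      W0_mono hlam fun σ => ind_le_one _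
    have h1 := (hrec j).err1
    have h2 : b * a * W1 b (h + 1) lam (below j ⁻¹' Γ) (fun _ => 1) ≤ b * a * (ω * q * w j) :=
      mul_le_mul_of_nonneg_left (hW1 j) (by positivity)
    rw [ht]; linarith
  have hnot0 : ∀ j,
      0 ≤ W0 b (h + 1) lam (below j ⁻¹' Γ) (fun σ => ind (¬ recon b m (h + 1) σ)) +
      W1 b (h + 1) lam (below j ⁻¹' Γ) (fun σ => ind (¬ recon b m (h + 1) σ)) := fun j =>
    add_nonneg (W0_nonneg hlam fun _ => ind_nonneg _) (W1_nonneg hlam fun _ => ind_nonneg _)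
  have hprodt : ∏ j, (w j * t) ≤
      q * t ^ b / (1 + ω) ^ b * W0 b (h + 1 + 1) lam Γ (fun _ => 1) := by
    rw [Finset.prod_mul_distrib, Finset.prod_const, Finset.card_univ, Fintype.card_fin]
    calc (∏ j, w j) * t ^ b
        ≤ (q / (1 + ω) ^ b * W0 b (h + 1 + 1) lam Γ (fun _ => 1)) * t ^ b :=
          mul_le_mul_of_nonneg_right hprod (by positivity)
      _ = _ := by ring
  have hWpos := (W0_one_pos hlam hΓ).le
  refine ⟨?_, ?_, ?_, ?_⟩
  · simp only [ind_recon_succ hm]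
    rw [W0_prod hΓ fun _ τ => ind (¬ recon b m (h + 1) τ)]
    calc _ ≤ ∏ j, (w j * t) := Finset.prod_le_prod (fun j _ => hnot0 j) fun j _ => hnot j
      _ ≤ _ := hprodt
      _ ≤ _ := mul_le_mul_of_nonneg_right hstep0 hWpos
  · rw [W1_not]
    simp only [ind_recon_succ hm]
    rw [W1_prod hΓ fun _ τ => ind (¬ recon b m (h + 1) τ), W1_one hΓ]
    have h1 : (1 - a) ^ b * ∏ j, w j ≤
        ∏ j, W0 b (h + 1) lam (below j ⁻¹' Γ) (fun τ => ind (¬ recon b m (h + 1) τ)) := by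
      have : (1 - a) ^ b * ∏ j, w j = ∏ j, ((1 - a) * w j) := by
        rw [Finset.prod_mul_distrib, Finset.prod_const, Finset.card_univ, Fintype.card_fin]
      rw [this]
      refine Finset.prod_le_prod (fun j _ => mul_nonneg (by linarith) (hw0 j).le) fun j _ => ?_
      rw [W0_not]
      have := (hrec j).err0
      simp only [hw] at this ⊢
      linarith
    have h2 : 1 - b * a ≤ (1 - a) ^ b := by
      have := one_add_mul_le_pow (a := -a) (by linarith) b
      simpa [sub_eq_add_neg] using this
    have h3 : (1 - b * a) * ∏ j, w j ≤ (1 - a) ^ b * ∏ j, w j :=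
      mul_le_mul_of_nonneg_right h2 (Finset.prod_nonneg fun j _ => (hw0 j).le)
    have h4 := mul_le_mul_of_nonneg_left (h3.trans h1) hlam.le
    change lam * ∏ j, w j - _ ≤ b * a * (lam * ∏ j, w j)
    linarith
  · rw [sum_vertex]
    have hroot : W0 b (h + 1 + 1) lam Γ
        (fun σ => ind (Pivotal (recon b m (h + 1 + 1)) (root b (h + 1 + 1)) σ)) = 0 := by
      simp [W0, wsum, ind_of_not (not_pivotal_recon_root hm _)]
    rw [hroot, zero_add]
    have hj : ∀ j, ∑ u, W0 b (h + 1 + 1) lam Γ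
        (fun σ => ind (Pivotal (recon b m (h + 1 + 1)) (below j u) σ)) ≤
        (φ ^ k + b * φ ^ k / φ * (ω * q)) * ∏ i, (w i * t) := by
      intro j
      have hu : ∀ u, W0 b (h + 1 + 1) lam Γ
          (fun σ => ind (Pivotal (recon b m (h + 1 + 1)) (below j u) σ)) =
          (W0 b (h + 1) lam (below j ⁻¹' Γ) (fun σ => ind (Pivotal (recon b m (h + 1)) u σ)) +
          W1 b (h + 1) lam (below j ⁻¹' Γ) (fun σ => ind (Pivotal (recon b m (h + 1)) u σ))) *
          ∏ i ∈ Finset.univ.erase j,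
            (W0 b (h + 1) lam (below i ⁻¹' Γ) (fun σ => ind (¬ recon b m (h + 1) σ)) +
            W1 b (h + 1) lam (below i ⁻¹' Γ) (fun σ => ind (¬ recon b m (h + 1) σ))) := by
        intro u
        simp only [ind_pivotal_below hm]
        rw [W0_prod hΓ fun i τ => if i = j then ind (Pivotal (recon b m (h + 1)) u τ)
          else ind (¬ recon b m (h + 1) τ), ← Finset.mul_prod_erase _ _ (Finset.mem_univ j)]
        simp only [if_true]
        congr 1
        refine Finset.prod_congr rfl fun i hi => ?_
        simp only [Finset.ne_of_mem_erase hi, if_false]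
      simp only [hu]
      rw [← Finset.sum_mul, Finset.sum_add_distrib, ← Finset.mul_prod_erase _ (fun i => w i * t)
        (Finset.mem_univ j), ← mul_assoc]
      refine mul_le_mul ?_ (Finset.prod_le_prod (fun i _ => hnot0 i) fun i _ => hnot i)
        (Finset.prod_nonneg fun i _ => hnot0 i) ?_
      · have h0 := (hrec j).piv0
        have h1 := (hrec j).piv1
        have h2 : b * φ ^ k / φ * W1 b (h + 1) lam (below j ⁻¹' Γ) (fun _ => 1) ≤
            b * φ ^ k / φ * (ω * q * w j) := mul_le_mul_of_nonneg_left (hW1 j) (by positivity)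
        have h3 : (φ ^ k + b * φ ^ k / φ * (ω * q)) * w j ≤
            (φ ^ k + b * φ ^ k / φ * (ω * q)) * (w j * t) :=
          mul_le_mul_of_nonneg_left (le_mul_of_one_le_right (hw0 j).le ht1) (by positivity)
        refine le_trans ?_ h3
        rw [add_mul]
        linarith
      · have := (hw0 j).le
        positivity
    calc _ ≤ ∑ _j : Fin b, (φ ^ k + b * φ ^ k / φ * (ω * q)) * ∏ i, (w i * t) :=
          Finset.sum_le_sum fun j _ => hj j
      _ = (b * (φ ^ k + b * φ ^ k / φ * (ω * q))) * ∏ i, (w i * t) := by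
          rw [Finset.sum_const, Finset.card_univ, Fintype.card_fin, nsmul_eq_mul, mul_assoc]
      _ ≤ (b * (φ ^ k + b * φ ^ k / φ * (ω * q))) *
          (q * t ^ b / (1 + ω) ^ b * W0 b (h + 1 + 1) lam Γ (fun _ => 1)) :=
          mul_le_mul_of_nonneg_left hprodt (by positivity)
      _ = φ ^ k / φ * (b * (φ + b * ω * q) * (q * t ^ b / (1 + ω) ^ b)) *
          W0 b (h + 1 + 1) lam Γ (fun _ => 1) := by field_simp
      _ ≤ φ ^ k / φ * φ ^ 2 * W0 b (h + 1 + 1) lam Γ (fun _ => 1) := by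
          refine mul_le_mul_of_nonneg_right ?_ hWpos
          exact mul_le_mul_of_nonneg_left hstep1 (by positivity)
      _ = _ := by rw [pow_succ φ k]; field_simp
  · rw [sum_vertex]
    have hroot : W1 b (h + 1 + 1) lam Γ
        (fun σ => ind (Pivotal (recon b m (h + 1 + 1)) (root b (h + 1 + 1)) σ)) = 0 := by
      simp [W1, wsum, ind_of_not (not_pivotal_recon_root hm _)]
    rw [hroot, zero_add]
    have hj : ∀ j, ∑ u, W1 b (h + 1 + 1) lam Γ
        (fun σ => ind (Pivotal (recon b m (h + 1 + 1)) (below j u) σ)) ≤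
        φ ^ k * W1 b (h + 1 + 1) lam Γ (fun _ => 1) := by
      intro j
      have hu : ∀ u, W1 b (h + 1 + 1) lam Γ
          (fun σ => ind (Pivotal (recon b m (h + 1 + 1)) (below j u) σ)) =
          W0 b (h + 1) lam (below j ⁻¹' Γ) (fun σ => ind (Pivotal (recon b m (h + 1)) u σ)) *
          (lam * ∏ i ∈ Finset.univ.erase j,
            W0 b (h + 1) lam (below i ⁻¹' Γ) (fun σ => ind (¬ recon b m (h + 1) σ))) := by
        intro u
        simp only [ind_pivotal_below hm]
        rw [W1_prod hΓ fun i τ => if i = j then ind (Pivotal (recon b m (h + 1)) u τ)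
          else ind (¬ recon b m (h + 1) τ), ← Finset.mul_prod_erase _ _ (Finset.mem_univ j)]
        simp only [if_true]
        rw [mul_left_comm]
        congr 2
        refine Finset.prod_congr rfl fun i hi => ?_
        simp only [Finset.ne_of_mem_erase hi, if_false]
      simp only [hu]
      rw [← Finset.sum_mul, W1_one hΓ, ← Finset.mul_prod_erase _ _ (Finset.mem_univ j),
        mul_left_comm lam, ← mul_assoc (φ ^ k)]
      have hnn : ∀ i, 0 ≤ W0 b (h + 1) lam (below i ⁻¹' Γ)
          (fun σ => ind (¬ recon b m (h + 1) σ)) := fun i => W0_nonneg hlam fun _ => ind_nonneg _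
      refine mul_le_mul (hrec j).piv0 ?_ (mul_nonneg hlam.le (Finset.prod_nonneg fun i _ => hnn i))
        (mul_nonneg (by positivity) (hw0 j).le)
      exact mul_le_mul_of_nonneg_left (Finset.prod_le_prod (fun i _ => hnn i)
        fun i _ => W0_mono hlam fun σ => ind_le_one _) hlam.le
    calc _ ≤ ∑ _j : Fin b, φ ^ k * W1 b (h + 1 + 1) lam Γ (fun _ => 1) :=
          Finset.sum_le_sum fun j _ => hj j
      _ = _ := by
          rw [Finset.sum_const, Finset.card_univ, Fintype.card_fin, nsmul_eq_mul, pow_succ]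
          field_simp

end Reconstruction

/-! ### The boundary conditions -/

section Boundary

variable {b h : ℕ} {ω : ℝ}

lemma glue_subset {l : ℕ} {A B : Set (Vertex b h)} (hA : A ⊆ leaves b h) (hB : B ⊆ leaves b h) :
    glue l A B ⊆ leaves b (h + 1) := by
  rintro v ⟨j, u, rfl, hu⟩
  rw [below_mem_leaves]
  split_ifs at hu
  exacts [hA hu, hB hu]

lemma preimage_below_glue (l : ℕ) (A B : Set (Vertex b h)) (j : Fin b) :
    below j ⁻¹' (glue l A B) = if j.val < l then A else B := by
  ext u
  constructor
  · rintro ⟨j', u', heq, hu⟩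
    obtain ⟨rfl, rfl⟩ := below_inj.1 heq
    split_ifs at hu ⊢ <;> exact hu
  · intro hu
    refine ⟨j, u, rfl, ?_⟩
    split_ifs at hu ⊢ <;> exact hu

lemma gamma_subset (b : ℕ) (ω : ℝ) (k : ℕ) :
    gammaU b ω k ⊆ leaves b (k + 1) ∧ gammaL b ω k ⊆ leaves b (k + 1) := by
  induction k with
  | zero => exact ⟨Set.empty_subset _, subset_rfl⟩
  | succ k ih => exact ⟨glue_subset ih.1 ih.2, glue_subset ih.1 ih.2⟩

lemma qValue_glue {A B : Set (Vertex b (h + 1))} (hω : 0 < ω) (hA : A ⊆ leaves b (h + 1))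
    (hB : B ⊆ leaves b (h + 1)) {l : ℕ} (hl : l ≤ b) :
    qValue b (h + 1 + 1) ω (glue l A B) =
      mixedQ b ω (qValue b (h + 1) ω A) (qValue b (h + 1) ω B) l := by
  rw [qValue_succ hω (glue_subset hA hB), mixedQ]
  congr 1
  simp only [preimage_below_glue]
  have : ∀ j : Fin b, 1 + ω * qValue b (h + 1) ω (if j.val < l then A else B) =
      if j.val < l then 1 + ω * qValue b (h + 1) ω A else 1 + ω * qValue b (h + 1) ω B := by
    intro j; split_ifs <;> rfl
  simp only [this]
  rw [Fin.prod_univ_eq_prod_range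
    (fun j => if j < l then 1 + ω * qValue b (h + 1) ω A else 1 + ω * qValue b (h + 1) ω B) b,
    ← Finset.prod_range_mul_prod_Ico _ hl]
  congr 1
  · rw [Finset.prod_congr rfl fun j hj => if_pos (Finset.mem_range.1 hj), Finset.prod_const,
      Finset.card_range]
  · rw [Finset.prod_congr rfl fun j hj => if_neg (Nat.not_lt.2 (Finset.mem_Ico.1 hj).1),
      Finset.prod_const, Nat.card_Ico]

lemma mixedQ_zero_ge {qU qL : ℝ} (hω : 0 < ω) (hL : 0 ≤ qL) (hL1 : qL ≤ 1) :
    1 ≤ mixedQ b ω qU qL 0 := by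
  rw [mixedQ, pow_zero, one_mul, Nat.sub_zero, one_le_div (by positivity)]
  exact pow_le_pow_left₀ (by positivity) (by nlinarith) b

lemma mixedQ_self_le {qU qL : ℝ} (hω : 0 < ω) (hU : 1 ≤ qU) :
    mixedQ b ω qU qL b ≤ 1 := by
  have : 0 < 1 + ω * qU := by positivity
  rw [mixedQ, Nat.sub_self, pow_zero, mul_one, div_le_one (by positivity)]
  exact pow_le_pow_left₀ (by positivity) (by nlinarith) b

lemma mixedQ_succ {qU qL : ℝ} (hω : 0 < ω) (hL : 0 ≤ qL) (hU : 1 ≤ qU) {l : ℕ} (hl : l < b) :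
    mixedQ b ω qU qL l * (1 + ω * qL) = mixedQ b ω qU qL (l + 1) * (1 + ω * qU) := by
  have hU' : 0 < 1 + ω * qU := by positivity
  have hL' : 0 < 1 + ω * qL := by positivity
  obtain ⟨d, rfl⟩ := Nat.exists_eq_add_of_lt hl
  have e1 : l + d + 1 - l = d + 1 := by omega
  have e2 : l + d + 1 - (l + 1) = d := by omega
  rw [mixedQ, mixedQ, e1, e2]
  generalize (1 + ω) ^ (l + d + 1) = c
  field_simp
  ring

lemma upperCount_spec {qU qL : ℝ} (hω : 0 < ω) (hL : 0 ≤ qL) (hL1 : qL ≤ 1) :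
    upperCount b ω qU qL ≤ b ∧ 1 ≤ mixedQ b ω qU qL (upperCount b ω qU qL) ∧
      ∀ k ≤ b, 1 ≤ mixedQ b ω qU qL k →
        mixedQ b ω qU qL (upperCount b ω qU qL) ≤ mixedQ b ω qU qL k := by
  have hne : ((Finset.range (b + 1)).filter fun l => 1 ≤ mixedQ b ω qU qL l).Nonempty :=
    ⟨0, by simp [mixedQ_zero_ge hω hL hL1]⟩
  obtain ⟨l, hl, hmin⟩ := Finset.exists_min_image _ (mixedQ b ω qU qL) hne
  simp only [Finset.mem_filter, Finset.mem_range, Nat.lt_succ_iff] at hl hmin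
  exact Nat.sSup_mem (s := {l | l ≤ b ∧ 1 ≤ mixedQ b ω qU qL l ∧
    ∀ k ≤ b, 1 ≤ mixedQ b ω qU qL k → mixedQ b ω qU qL l ≤ mixedQ b ω qU qL k})
    ⟨l, hl.1, hl.2, fun k hk h1 => hmin k ⟨hk, h1⟩⟩ ⟨b, fun k hk => hk.1⟩

lemma lowerCount_spec {qU qL : ℝ} (hω : 0 < ω) (hU : 1 ≤ qU) :
    lowerCount b ω qU qL ≤ b ∧ mixedQ b ω qU qL (lowerCount b ω qU qL) ≤ 1 ∧
      ∀ k ≤ b, mixedQ b ω qU qL k ≤ 1 →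
        mixedQ b ω qU qL k ≤ mixedQ b ω qU qL (lowerCount b ω qU qL) := by
  have hne : ((Finset.range (b + 1)).filter fun l => mixedQ b ω qU qL l ≤ 1).Nonempty :=
    ⟨b, by simp [mixedQ_self_le hω hU]⟩
  obtain ⟨l, hl, hmax⟩ := Finset.exists_max_image _ (mixedQ b ω qU qL) hne
  simp only [Finset.mem_filter, Finset.mem_range, Nat.lt_succ_iff] at hl hmax
  exact Nat.sSup_mem (s := {l | l ≤ b ∧ mixedQ b ω qU qL l ≤ 1 ∧
    ∀ k ≤ b, mixedQ b ω qU qL k ≤ 1 → mixedQ b ω qU qL k ≤ mixedQ b ω qU qL l})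
    ⟨l, hl.1, hl.2, fun k hk h1 => hmax k ⟨hk, h1⟩⟩ ⟨b, fun k hk => hk.1⟩

/-- The two values chosen on the two sides of `1` are at most one replacement of a subtree apart. -/
lemma mixedQ_upper_le_lower {qU qL : ℝ} (hω : 0 < ω) (hL : 0 ≤ qL) (hL1 : qL ≤ 1)
    (hU : 1 ≤ qU) :
    mixedQ b ω qU qL (upperCount b ω qU qL) * (1 + ω * qL) ≤
      mixedQ b ω qU qL (lowerCount b ω qU qL) * (1 + ω * qU) := by
  obtain ⟨-, -, hmin⟩ := upperCount_spec (b := b) (qU := qU) hω hL hL1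
  obtain ⟨-, -, hmax⟩ := lowerCount_spec (b := b) (qL := qL) hω hU
  have hU' : 0 < 1 + ω * qU := by positivity
  have hL' : 0 < 1 + ω * qL := by positivity
  by_cases hex : ∃ l < b, 1 ≤ mixedQ b ω qU qL l ∧ mixedQ b ω qU qL (l + 1) ≤ 1
  · obtain ⟨l, hl, h1, h2⟩ := hex
    calc _ ≤ mixedQ b ω qU qL l * (1 + ω * qL) :=
          mul_le_mul_of_nonneg_right (hmin l hl.le h1) hL'.le
      _ = mixedQ b ω qU qL (l + 1) * (1 + ω * qU) := mixedQ_succ hω hL hU hl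
      _ ≤ _ := mul_le_mul_of_nonneg_right (hmax (l + 1) hl h2) hU'.le
  · -- otherwise all values are at least `1`, and the last one is equal to `1`
    push Not at hex
    have hall : ∀ l, l ≤ b → 1 ≤ mixedQ b ω qU qL l := by
      intro l
      induction l with
      | zero => exact fun _ => mixedQ_zero_ge hω hL hL1
      | succ l ih => exact fun hl => (hex l hl (ih (Nat.le_of_succ_le hl))).le
    calc _ ≤ mixedQ b ω qU qL b * (1 + ω * qL) :=
          mul_le_mul_of_nonneg_right (hmin b le_rfl (hall b le_rfl)) hL'.le
      _ ≤ mixedQ b ω qU qL b * (1 + ω * qU) := by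
          refine mul_le_mul_of_nonneg_left ?_ (zero_le_one.trans (hall b le_rfl))
          nlinarith
      _ ≤ _ := mul_le_mul_of_nonneg_right (hmax b le_rfl (mixedQ_self_le hω hU)) hU'.le

lemma mem_leaves_zero (v : Vertex b 0) : v ∈ leaves b 0 := Nat.le_zero.1 v.2

lemma qValue_gammaU_zero (hω : 0 < ω) : 1 ≤ qValue b (0 + 1) ω (gammaU b ω 0) := by
  have hsub := (gamma_subset b ω 0).1
  rw [qValue_one_eq hω hsub, W0_one hsub]
  have hW1 : ∀ j : Fin b, W1 b 0 (activity b ω) (below j ⁻¹' (gammaU b ω 0)) (fun _ => 1) = 0 := by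
    intro j
    refine Finset.sum_eq_zero fun σ _ => ?_
    by_cases hσ : root b 0 ∈ σ
    · rw [weight_of_not, zero_mul]
      rintro ⟨-, heq⟩
      have : root b 0 ∈ below j ⁻¹' (gammaU b ω 0) := by
        rw [← heq]; exact ⟨hσ, mem_leaves_zero _⟩
      exact this
    · simp only [ind_of_not hσ, zero_mul, mul_zero]
  have hpos := W0_one_pos (activity_pos (b := b) hω) hsub
  rw [W0_one hsub] at hpos
  simp only [hW1, add_zero] at hpos ⊢
  rw [mul_div_assoc, div_self hpos.ne', mul_one]
  exact one_le_pow₀ (by linarith)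

lemma qValue_gammaL_zero (hb : 2 ≤ b) (hω : 0 < ω) : qValue b (0 + 1) ω (gammaL b ω 0) = 0 := by
  have hsub := (gamma_subset b ω 0).2
  rw [qValue_one_eq hω hsub]
  have hW0 : W0 b 0 (activity b ω) (below ⟨0, by omega⟩ ⁻¹' (gammaL b ω 0)) (fun _ => 1) = 0 := by
    refine Finset.sum_eq_zero fun σ _ => ?_
    by_cases hσ : root b 0 ∈ σ
    · simp only [ind_of_not (not_not.2 hσ), zero_mul, mul_zero]
    · rw [weight_of_not, zero_mul]
      rintro ⟨-, heq⟩
      have : root b 0 ∈ below ⟨0, by omega⟩ ⁻¹' (gammaL b ω 0) :=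
        below_mem_leaves.2 (mem_leaves_zero _)
      rw [← heq] at this
      exact hσ this.1
  rw [Finset.prod_eq_zero (Finset.mem_univ ⟨0, by omega⟩) hW0, mul_zero, zero_div]

lemma qValue_gamma_bounds (hb : 2 ≤ b) (hω : 0 < ω) (k : ℕ) :
    1 ≤ qValue b (k + 1) ω (gammaU b ω k) ∧ 0 ≤ qValue b (k + 1) ω (gammaL b ω k) ∧
      qValue b (k + 1) ω (gammaL b ω k) ≤ 1 := by
  refine ⟨?_, qValue_nonneg hω (gamma_subset b ω k).2, ?_⟩
  all_goals
    have key : 1 ≤ qValue b (k + 1) ω (gammaU b ω k) ∧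
        qValue b (k + 1) ω (gammaL b ω k) ≤ 1 := by
      induction k with
      | zero => exact ⟨qValue_gammaU_zero hω, by rw [qValue_gammaL_zero hb hω]; exact zero_le_one⟩
      | succ k ih =>
        obtain ⟨hA, hB⟩ := gamma_subset b ω k
        have h0 := qValue_nonneg hω hB
        have hu := upperCount_spec (b := b) (qU := qValue b (k + 1) ω (gammaU b ω k)) hω h0 ih.2
        have hl := lowerCount_spec (b := b) (qL := qValue b (k + 1) ω (gammaL b ω k)) hω ih.1
        exact ⟨(qValue_glue hω hA hB hu.1).symm ▸ hu.2.1, (qValue_glue hω hA hB hl.1).symm ▸ hl.2.1⟩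
    first | exact key.1 | exact key.2

/-- The `Q`-values of the two boundary conditions on the next tree are at most as far apart as the
factors that a single subtree contributes. -/
lemma qValue_gamma_succ (hb : 2 ≤ b) (hω : 0 < ω) (k : ℕ) :
    qValue b (k + 1 + 1) ω (gammaU b ω (k + 1)) * (1 + ω * qValue b (k + 1) ω (gammaL b ω k)) ≤
      qValue b (k + 1 + 1) ω (gammaL b ω (k + 1)) *
        (1 + ω * qValue b (k + 1) ω (gammaU b ω k)) := by
  obtain ⟨hA, hB⟩ := gamma_subset b ω k
  obtain ⟨h1, h0, h2⟩ := qValue_gamma_bounds hb hω k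
  have hu := upperCount_spec (b := b) (qU := qValue b (k + 1) ω (gammaU b ω k)) hω h0 h2
  have hl := lowerCount_spec (b := b) (qL := qValue b (k + 1) ω (gammaL b ω k)) hω h1
  have := mixedQ_upper_le_lower (b := b) hω h0 h2 h1
  rw [← qValue_glue hω hA hB hu.1, ← qValue_glue hω hA hB hl.1] at this
  exact this

lemma qValue_gammaL_pos (hω : 0 < ω) (k : ℕ) :
    0 < qValue b (k + 1 + 1) ω (gammaL b ω (k + 1)) := by
  have hsub := (gamma_subset b ω (k + 1)).2
  have hlam := activity_pos (b := b) hω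
  have h1 := W1_one_pos hlam hsub
  rw [W1_eq_qValue_mul hω hsub] at h1
  have h2 := pos_of_mul_pos_left h1 (W0_one_pos hlam hsub).le
  exact pos_of_mul_pos_right h2 hω.le

/-- The ratio of the `Q`-values of the two boundary conditions tends to `1` geometrically, with
rate `ω / (1 + ω)`. -/
lemma qValue_gamma_ratio (hb : 2 ≤ b) (hω : 0 < ω) (k : ℕ) :
    qValue b (k + 1 + 1) ω (gammaU b ω (k + 1)) / qValue b (k + 1 + 1) ω (gammaL b ω (k + 1)) - 1 ≤
      (ω / (1 + ω)) ^ k * (qValue b (0 + 1 + 1) ω (gammaU b ω (0 + 1)) /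
        qValue b (0 + 1 + 1) ω (gammaL b ω (0 + 1)) - 1) := by
  induction k with
  | zero => simp
  | succ k ih =>
    have hpos := qValue_gammaL_pos (b := b) hω k
    have hpos' := qValue_gammaL_pos (b := b) hω (k + 1)
    obtain ⟨h1, -, h2⟩ := qValue_gamma_bounds hb hω (k + 1)
    have hs := qValue_gamma_succ hb hω (k + 1)
    rw [pow_succ, mul_comm _ (ω / (1 + ω)), mul_assoc]
    refine le_trans ?_ (mul_le_mul_of_nonneg_left ih (by positivity))
    generalize qValue b (k + 1 + 1) ω (gammaU b ω (k + 1)) = u at *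
    generalize qValue b (k + 1 + 1) ω (gammaL b ω (k + 1)) = l at *
    generalize qValue b (k + 1 + 1 + 1) ω (gammaU b ω (k + 1 + 1)) = u' at *
    generalize qValue b (k + 1 + 1 + 1) ω (gammaL b ω (k + 1 + 1)) = l' at *
    have hl0 : 0 < 1 + ω * l := by positivity
    calc u' / l' - 1 ≤ (1 + ω * u) / (1 + ω * l) - 1 := by
          refine sub_le_sub_right ?_ 1
          rw [div_le_div_iff₀ hpos' hl0, mul_comm (1 + ω * u)]
          exact hs
      _ = ω * (u - l) / (1 + ω * l) := by field_simp; ring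
      _ ≤ ω * (u - l) / (l * (1 + ω)) := by
          refine div_le_div_of_nonneg_left ?_ (by positivity) (by nlinarith)
          exact mul_nonneg hω.le (by linarith)
      _ = ω / (1 + ω) * (u / l - 1) := by field_simp

/-- The `Q`-values of both boundary conditions tend to `1`. -/
lemma eventually_qValue_gamma (hb : 2 ≤ b) (hω : 0 < ω) {q : ℝ} (hq : 1 < q) :
    ∃ k₀, ∀ k, k₀ ≤ k → qValue b (k + 1) ω (gammaU b ω k) ≤ q ∧
      q⁻¹ ≤ qValue b (k + 1) ω (gammaL b ω k) := by
  have hr : Tendsto (fun k : ℕ => (ω / (1 + ω)) ^ k *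
      (qValue b (0 + 1 + 1) ω (gammaU b ω (0 + 1)) /
        qValue b (0 + 1 + 1) ω (gammaL b ω (0 + 1)) - 1)) atTop (nhds 0) := by
    have := (tendsto_pow_atTop_nhds_zero_of_lt_one (r := ω / (1 + ω)) (by positivity)
      (by rw [div_lt_one (by positivity)]; linarith)).mul_const
      (qValue b (0 + 1 + 1) ω (gammaU b ω (0 + 1)) /
        qValue b (0 + 1 + 1) ω (gammaL b ω (0 + 1)) - 1)
    rwa [zero_mul] at this
  obtain ⟨N, hN⟩ := eventually_atTop.1 (hr.eventually (gt_mem_nhds (sub_pos.2 hq)))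
  refine ⟨N + 1, fun k hk => ?_⟩
  obtain ⟨k, rfl⟩ := Nat.exists_eq_add_of_le' (Nat.le_of_lt_succ (Nat.lt_succ_of_le hk))
  have hk' := (qValue_gamma_ratio hb hω (k + N)).trans (hN (k + N) (Nat.le_add_left _ _)).le
  obtain ⟨h1, -, h2⟩ := qValue_gamma_bounds hb hω (k + (N + 1))
  have hpos := qValue_gammaL_pos (b := b) hω (k + N)
  change 0 < qValue b (k + (N + 1) + 1) ω (gammaL b ω (k + (N + 1))) at hpos
  change qValue b (k + (N + 1) + 1) ω (gammaU b ω (k + (N + 1))) /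
    qValue b (k + (N + 1) + 1) ω (gammaL b ω (k + (N + 1))) - 1 ≤ q - 1 at hk'
  generalize qValue b (k + (N + 1) + 1) ω (gammaU b ω (k + (N + 1))) = u at *
  generalize qValue b (k + (N + 1) + 1) ω (gammaL b ω (k + (N + 1))) = l at *
  have hul : u ≤ q * l := by
    rw [← div_le_iff₀ hpos]; linarith
  constructor
  · nlinarith
  · rw [inv_le_iff_one_le_mul₀ (by linarith)]
    linarith

end Boundary

/-! ### The lower bound on the relaxation time -/

section LowerBound

variable {b m h k : ℕ} {ω a φ q : ℝ}

/-- The reconstruction of the root separates the state space into two parts of comparable weight,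
with few transitions between them. -/
lemma ReconBound.le_treeRelaxationTime (hω : 0 < ω) (hb : 1 ≤ b) (ha : b * a ≤ 1 / 2)
    (ha0 : 0 ≤ a) (hφ : 0 < φ) (hφb : φ ≤ b) {Γ : Set (Vertex b (h + 1 + 1))}
    (hΓ : Γ ⊆ leaves b (h + 1 + 1))
    (hq : qValue b (h + 1 + 1) ω Γ ≤ q) (hq' : 1 / 2 ≤ qValue b (h + 1 + 1) ω Γ)
    (hrec : ReconBound b m (h + 1 + 1) (activity b ω) a φ k Γ) :
    ω * φ / (8 * b * (1 + ω * q) ^ 2) * ((numVertices b (h + 1 + 1) : ℝ) / φ ^ k) ≤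
      treeRelaxationTime b (h + 1 + 1) (activity b ω) Γ := by
  have hlam := activity_pos (b := b) hω
  have : Nonempty (Vertex b (h + 1 + 1)) := ⟨root b _⟩
  obtain ⟨hgap, hle⟩ := spectralGap_glauber hlam (exists_config_ne hΓ)
    (recon b m (h + 1 + 1))
  set g := spectralGap (glauber (tree b (h + 1 + 1)) (activity b ω) (leaves b (h + 1 + 1)) Γ)
  have hW1eq := W1_eq_qValue_mul hω hΓ
  have hW0pos := W0_one_pos hlam hΓ
  have e0 := hrec.err0
  have e1 := hrec.err1
  have p0 := hrec.piv0
  have p1 := hrec.piv1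
  simp only [← W0_add_W1] at hle
  rw [Finset.sum_add_distrib, W0_not] at hle
  have hn1 := W1_not (lam := activity b ω) (Γ := Γ) (recon b m (h + 1 + 1))
  have n0 : 0 ≤ W0 b (h + 1 + 1) (activity b ω) Γ (fun σ => ind (recon b m (h + 1 + 1) σ)) :=
    W0_nonneg hlam fun _ => ind_nonneg _
  have n1 : 0 ≤ W1 b (h + 1 + 1) (activity b ω) Γ (fun σ => ind (¬ recon b m (h + 1 + 1) σ)) :=
    W1_nonneg hlam fun _ => ind_nonneg _
  have hn : (0 : ℝ) < Fintype.card (Vertex b (h + 1 + 1)) := by exact_mod_cast Fintype.card_pos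
  rw [treeRelaxationTime, relaxationTime, numVertices]
  change _ ≤ g⁻¹
  generalize (Fintype.card (Vertex b (h + 1 + 1)) : ℝ) = n at *
  generalize qValue b (h + 1 + 1) ω Γ = Q at *
  generalize W1 b (h + 1 + 1) (activity b ω) Γ (fun _ => 1) = w1 at *
  generalize W0 b (h + 1 + 1) (activity b ω) Γ (fun _ => 1) = w0 at *
  generalize W0 b (h + 1 + 1) (activity b ω) Γ (fun σ => ind (recon b m (h + 1 + 1) σ)) = x0 at *
  generalize W1 b (h + 1 + 1) (activity b ω) Γ (fun σ => ind (recon b m (h + 1 + 1) σ)) = x1 at *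
  generalize W1 b (h + 1 + 1) (activity b ω) Γ (fun σ => ind (¬ recon b m (h + 1 + 1) σ)) = y1 at *
  generalize ∑ v, W0 b (h + 1 + 1) (activity b ω) Γ
    (fun σ => ind (Pivotal (recon b m (h + 1 + 1)) v σ)) = s0 at *
  generalize ∑ v, W1 b (h + 1 + 1) (activity b ω) Γ
    (fun σ => ind (Pivotal (recon b m (h + 1 + 1)) v σ)) = s1 at *
  have hb1 : (1 : ℝ) ≤ b := by exact_mod_cast hb
  have hw1 : ω / 2 * w0 ≤ w1 := by rw [hW1eq]; nlinarith [mul_pos hω hW0pos]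
  have hw1' : w1 ≤ ω * q * w0 := by
    rw [hW1eq]
    exact mul_le_mul_of_nonneg_right (mul_le_mul_of_nonneg_left hq hω.le) hW0pos.le
  have hw1pos : 0 < w1 := lt_of_lt_of_le (by positivity) hw1
  have hahalf : a ≤ 1 / 2 := by nlinarith
  have hx1 : w1 / 2 ≤ x1 := by nlinarith
  have hx0 : w0 / 2 ≤ w0 - x0 := by nlinarith
  have hlow : ω / 8 * w0 ^ 2 ≤ (x0 + x1) * (w0 - x0 + y1) := by
    calc ω / 8 * w0 ^ 2 = (ω / 2 * w0 / 2) * (w0 / 2) := by ring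
      _ ≤ (x0 + x1) * (w0 - x0 + y1) :=
        mul_le_mul (by linarith) (by linarith) (by positivity) (by linarith)
  have hφk : 0 < φ ^ k := pow_pos hφ k
  have hone : 1 ≤ b / φ := by rwa [one_le_div hφ]
  have hs0 : s0 ≤ b * φ ^ k / φ * w0 := by
    refine p0.trans (mul_le_mul_of_nonneg_right ?_ hW0pos.le)
    rw [mul_comm, mul_div_assoc]
    exact le_mul_of_one_le_right hφk.le hone
  have hup : (w0 + w1) * (s0 + s1) ≤ b * φ ^ k / φ * ((1 + ω * q) ^ 2 * w0 ^ 2) := by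
    have h1 : w0 + w1 ≤ (1 + ω * q) * w0 := by linarith
    have h2 : s0 + s1 ≤ b * φ ^ k / φ * (w0 + w1) := by linarith
    have hc : 0 < b * φ ^ k / φ := by positivity
    calc (w0 + w1) * (s0 + s1) ≤ (w0 + w1) * (b * φ ^ k / φ * (w0 + w1)) :=
          mul_le_mul_of_nonneg_left h2 (by linarith)
      _ = b * φ ^ k / φ * (w0 + w1) ^ 2 := by ring
      _ ≤ b * φ ^ k / φ * ((1 + ω * q) * w0) ^ 2 :=
          mul_le_mul_of_nonneg_left (pow_le_pow_left₀ (by linarith) h1 2) hc.le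
      _ = _ := by ring
  have hmain : g * (ω / 8 * w0 ^ 2) ≤ b * φ ^ k / φ * ((1 + ω * q) ^ 2 * w0 ^ 2) / n :=
    (mul_le_mul_of_nonneg_left hlow hgap.le).trans (hle.trans (div_le_div_of_nonneg_right hup hn.le))
  have hq0 : 0 < 1 + ω * q := by nlinarith
  rw [← one_div, le_div_iff₀ hgap]
  rw [le_div_iff₀ hn] at hmain
  have h3 : g * (ω / 8) * n ≤ b * φ ^ k / φ * (1 + ω * q) ^ 2 := by
    refine le_of_mul_le_mul_right ?_ (pow_pos hW0pos 2)
    linarith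
  calc ω * φ / (8 * b * (1 + ω * q) ^ 2) * (n / φ ^ k) * g
      = (g * (ω / 8) * n) / (b * φ ^ k / φ * (1 + ω * q) ^ 2) := by field_simp
    _ ≤ 1 := div_le_one_of_le₀ h3 (by positivity)

/-- Once the `Q`-values are at most `q`, the quality of the reconstruction is maintained. -/
lemma reconBound_gamma (hω : 0 < ω) (ha : 0 ≤ a) (ha1 : a ≤ 1) (hφ : 0 < φ)
    (hφb : φ ≤ b) {k₀ : ℕ}
    (hqU : ∀ k, k₀ ≤ k → qValue b (k + 1) ω (gammaU b ω k) ≤ q)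
    (hqL : ∀ k, k₀ ≤ k → qValue b (k + 1) ω (gammaL b ω k) ≤ q)
    (hstep0 : q * (1 + b * a * (ω * q)) ^ b / (1 + ω) ^ b ≤ a)
    (hstep1 : b * (φ + b * ω * q) * (q * (1 + b * a * (ω * q)) ^ b / (1 + ω) ^ b) ≤ φ ^ 2)
    (i : ℕ) :
    ReconBound b (k₀ + 1) (k₀ + i + 1) (activity b ω) a φ i (gammaU b ω (k₀ + i)) ∧
    ReconBound b (k₀ + 1) (k₀ + i + 1) (activity b ω) a φ i (gammaL b ω (k₀ + i)) := by
  have hlam := activity_pos (b := b) hω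
  induction i with
  | zero => exact ⟨reconBound_self hlam ha hφ hφb _, reconBound_self hlam ha hφ hφb _⟩
  | succ i ih =>
    have hsub := gamma_subset b ω (k₀ + (i + 1))
    have hU := hqU (k₀ + (i + 1)) (Nat.le_add_right _ _)
    have hL := hqL (k₀ + (i + 1)) (Nat.le_add_right _ _)
    have hU' := hqU (k₀ + i) (Nat.le_add_right _ _)
    have hL' := hqL (k₀ + i) (Nat.le_add_right _ _)
    have hpre : ∀ (l : ℕ) (p : Set (Vertex b (k₀ + i + 1)) → Prop), p (gammaU b ω (k₀ + i)) →
        p (gammaL b ω (k₀ + i)) →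
        ∀ j, p (below j ⁻¹' glue l (gammaU b ω (k₀ + i)) (gammaL b ω (k₀ + i))) := by
      intro l p h1 h2 j
      rw [preimage_below_glue]
      split_ifs
      exacts [h1, h2]
    constructor
    · exact ReconBound.succ hω ha ha1 hφ (Nat.succ_le_succ (Nat.le_add_right k₀ i)) hsub.1 hU
        (hpre _ (fun Γ => qValue b (k₀ + i + 1) ω Γ ≤ q) hU' hL') (hpre _ _ ih.1 ih.2)
        hstep0 hstep1
    · exact ReconBound.succ hω ha ha1 hφ (Nat.succ_le_succ (Nat.le_add_right k₀ i)) hsub.2 hL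
        (hpre _ (fun Γ => qValue b (k₀ + i + 1) ω Γ ≤ q) hU' hL') (hpre _ _ ih.1 ih.2)
        hstep0 hstep1

/-- If the expected number of pivotal vertices decays by a factor of `φ` per level, then the
relaxation time grows like `n / φ ^ h`. -/
theorem exists_le_treeRelaxationTime (hω : 0 < ω) (hb : 2 ≤ b) (ha : 0 ≤ a) (hab : b * a ≤ 1 / 2)
    (hφ : 0 < φ) (hφ1 : φ ≤ 1) (hq1 : 1 < q) (hq2 : q ≤ 2)
    (hstep0 : q * (1 + b * a * (ω * q)) ^ b / (1 + ω) ^ b ≤ a)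
    (hstep1 : b * (φ + b * ω * q) * (q * (1 + b * a * (ω * q)) ^ b / (1 + ω) ^ b) ≤ φ ^ 2) :
    ∃ c : ℝ, 0 < c ∧ ∀ᶠ k : ℕ in atTop,
      c * ((numVertices b (k + 1) : ℝ) / φ ^ (k + 1)) ≤
        treeRelaxationTime b (k + 1) (activity b ω) (gammaU b ω k) ∧
      c * ((numVertices b (k + 1) : ℝ) / φ ^ (k + 1)) ≤
        treeRelaxationTime b (k + 1) (activity b ω) (gammaL b ω k) := by
  obtain ⟨k₀, hk₀⟩ := eventually_qValue_gamma hb hω hq1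
  have hb1 : (1 : ℝ) ≤ b := by exact_mod_cast (by omega : 1 ≤ b)
  have hqinv : 1 / 2 ≤ q⁻¹ := by rw [one_div]; exact inv_anti₀ (by linarith) hq2
  have hU : ∀ k, k₀ ≤ k → qValue b (k + 1) ω (gammaU b ω k) ≤ q := fun k hk => (hk₀ k hk).1
  have hL : ∀ k, k₀ ≤ k → qValue b (k + 1) ω (gammaL b ω k) ≤ q := fun k _ =>
    (qValue_gamma_bounds hb hω k).2.2.trans hq1.le
  have hrec := reconBound_gamma hω ha (by nlinarith) hφ (hφ1.trans hb1) hU hL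
    hstep0 hstep1
  have hφk : 0 < φ ^ (k₀ + 1) := pow_pos hφ _
  refine ⟨ω * φ / (8 * b * (1 + ω * q) ^ 2) * φ ^ (k₀ + 1), by positivity, ?_⟩
  filter_upwards [eventually_ge_atTop (k₀ + 1)] with k hk
  obtain ⟨i, rfl⟩ := Nat.exists_eq_add_of_le hk
  have hexp : ∀ n : ℝ, ω * φ / (8 * b * (1 + ω * q) ^ 2) * φ ^ (k₀ + 1) *
      (n / φ ^ (k₀ + 1 + i + 1)) = ω * φ / (8 * b * (1 + ω * q) ^ 2) * (n / φ ^ (i + 1)) := by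
    intro n
    have : φ ^ (k₀ + 1 + i + 1) = φ ^ (k₀ + 1) * φ ^ (i + 1) := by ring
    rw [this]
    field_simp
  rw [hexp]
  have hidx : k₀ + 1 + i = k₀ + (i + 1) := by omega
  rw [hidx]
  have hr := hrec (i + 1)
  have hb' := qValue_gamma_bounds hb hω (k₀ + (i + 1))
  have hk' := hk₀ (k₀ + (i + 1)) (Nat.le_add_right _ _)
  have hsub := gamma_subset b ω (k₀ + (i + 1))
  exact ⟨hr.1.le_treeRelaxationTime hω (by omega) hab ha hφ (hφ1.trans hb1) hsub.1
      hk'.1 ((by norm_num : (1 / 2 : ℝ) ≤ 1).trans hb'.1),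
    hr.2.le_treeRelaxationTime hω (by omega) hab ha hφ (hφ1.trans hb1) hsub.2
      (hb'.2.2.trans hq1.le) (hqinv.trans hk'.2)⟩

end LowerBound

/-! ### The parameters -/

section Parameters

variable {δ : ℝ} {b : ℕ}

lemma log_pos_of_two_le (hb : 2 ≤ b) : 0 < Real.log b :=
  Real.log_pos (by exact_mod_cast (by omega : 1 < b))

lemma omegaOf_pos (hδ : 0 < δ) (hb : 2 ≤ b) : 0 < omegaOf δ b := by
  have h1 := log_pos_of_two_le hb
  have h2 : (0 : ℝ) < b := by exact_mod_cast (by omega : 0 < b)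
  unfold omegaOf; positivity

lemma omegaOf_mul (hb : 2 ≤ b) : omegaOf δ b * b = (1 + δ) * Real.log b := by
  have h2 : (b : ℝ) ≠ 0 := by exact_mod_cast (by omega : b ≠ 0)
  rw [omegaOf]; field_simp

/-- A positive solution of `404 x ≤ exp x` that is not tiny is large. -/
lemma le_of_mul_le_exp {x : ℝ} (hx : 0.69 ≤ x) (h : 404 * x ≤ Real.exp x) : 7.2 ≤ x := by
  by_contra! hlt
  have he := Real.exp_one_lt_d9.le
  have hpow : ∀ n : ℕ, Real.exp n ≤ 2.7182818286 ^ n := fun n => by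
    rw [← mul_one (n : ℝ), Real.exp_nat_mul]
    exact pow_le_pow_left₀ (Real.exp_pos 1).le he n
  rcases le_total x 4 with h4 | h4
  · have h1 := Real.exp_le_exp.2 h4
    have h2 := hpow 4
    norm_num at h2
    linarith
  · have h1 := Real.exp_le_exp.2 hlt.le
    have h2 := hpow 7
    have h3 : Real.exp 0.2 ≤ 1.25 := by
      have h5 := Real.add_one_le_exp (-0.2)
      rw [Real.exp_neg] at h5
      have h6 : Real.exp 0.2 * (Real.exp 0.2)⁻¹ = 1 := mul_inv_cancel₀ (Real.exp_pos _).ne'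
      nlinarith [Real.exp_pos 0.2]
    have h5 : Real.exp 7.2 = Real.exp (7 : ℕ) * Real.exp 0.2 := by
      rw [← Real.exp_add]; norm_num
    have h6 : Real.exp (7 : ℕ) * Real.exp 0.2 ≤ 2.7182818286 ^ 7 * 1.25 :=
      mul_le_mul h2 h3 (Real.exp_pos _).le (by norm_num)
    rw [h5] at h1
    have h7 := h1.trans h6
    norm_num at h7
    linarith

/-- The size of the activity that is implicit in the definition of `b₀`. -/
lemma activity_ge {ω : ℝ} (hω : 0 < ω) (hb : 2 ≤ b) (hx : 0.69 ≤ ω * b)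
    (hexp : Real.exp (2 * 1.01 * (ω * b) ^ 2 / activity b ω) ≤ 1.01) :
    7.2 ≤ ω * b ∧ 202 * (ω * b) ^ 2 ≤ activity b ω := by
  have hlam := activity_pos (b := b) hω
  have hb2 : (2 : ℝ) ≤ b := by exact_mod_cast hb
  have h1 := (Real.add_one_le_exp _).trans hexp
  have h2 : 2 * 1.01 * (ω * b) ^ 2 / activity b ω ≤ 0.01 := by linarith
  rw [div_le_iff₀ hlam] at h2
  have h3 : 202 * (ω * b) ^ 2 ≤ activity b ω := by linarith
  refine ⟨le_of_mul_le_exp hx ?_, h3⟩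
  have h4 : (1 + ω) ^ b ≤ Real.exp (ω * b) := by
    have := pow_le_pow_left₀ (by positivity) (Real.add_one_le_exp ω) b
    rwa [← Real.exp_nat_mul, add_comm, mul_comm (b : ℝ)] at this
  have h5 : 202 * (ω * b) * b ≤ (1 + ω) ^ b := by
    rw [activity] at h3
    refine le_of_mul_le_mul_left ?_ hω
    calc ω * (202 * (ω * b) * b) = 202 * (ω * b) ^ 2 := by ring
      _ ≤ _ := h3
  nlinarith

/-- Conversion of the exponential decay per level into a power of the number of vertices. -/
lemma rpow_exponent_le {ω φ : ℝ} {h : ℕ} (hb : 2 ≤ b) (hφ : 0 < φ) (hφ1 : φ ≤ 1)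
    (hφeq : activity b ω / (1.01 * ω * b) ^ 2 = (φ ^ 2)⁻¹) :
    (numVertices b h : ℝ) ^ exponent b ω ≤
      (2 : ℝ) ^ (exponent b ω - 1) * ((numVertices b h : ℝ) / φ ^ h) := by
  have hlog := log_pos_of_two_le hb
  have hb0 : (0 : ℝ) < b := by exact_mod_cast (by omega : 0 < b)
  have hexp : exponent b ω - 1 = -Real.log φ / Real.log b := by
    rw [exponent, hφeq, Real.log_inv, Real.log_pow]
    push_cast
    field_simp
    ring
  have hnn : 0 ≤ exponent b ω - 1 := by
    rw [hexp]
    exact div_nonneg (neg_nonneg.2 (Real.log_nonpos hφ.le hφ1)) hlog.le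
  have hbpow : (b : ℝ) ^ (exponent b ω - 1) = φ⁻¹ := by
    rw [hexp, Real.rpow_def_of_pos hb0, mul_div_cancel₀ _ hlog.ne', Real.exp_neg, Real.exp_log hφ]
  have hn : 0 < (numVertices b h : ℝ) := by
    exact_mod_cast lt_of_lt_of_le (pow_pos (by omega : 0 < b) h) (pow_le_numVertices b h)
  have hle : (numVertices b h : ℝ) ≤ 2 * (b : ℝ) ^ h := by exact_mod_cast numVertices_le hb h
  have h1 : (numVertices b h : ℝ) ^ (exponent b ω - 1) ≤
      (2 : ℝ) ^ (exponent b ω - 1) * (φ ^ h)⁻¹ := by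
    calc _ ≤ (2 * (b : ℝ) ^ h) ^ (exponent b ω - 1) := Real.rpow_le_rpow hn.le hle hnn
      _ = (2 : ℝ) ^ (exponent b ω - 1) * ((b : ℝ) ^ (exponent b ω - 1)) ^ h := by
        rw [Real.mul_rpow (by norm_num) (by positivity), ← Real.rpow_natCast, ← Real.rpow_mul hb0.le,
          mul_comm (h : ℝ), Real.rpow_mul hb0.le, Real.rpow_natCast]
      _ = _ := by rw [hbpow, inv_pow]
  calc (numVertices b h : ℝ) ^ exponent b ω
      = (numVertices b h : ℝ) ^ (exponent b ω - 1) * numVertices b h := by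
        rw [← Real.rpow_add_one hn.ne']; congr 1; ring
    _ ≤ (2 : ℝ) ^ (exponent b ω - 1) * (φ ^ h)⁻¹ * numVertices b h :=
        mul_le_mul_of_nonneg_right h1 hn.le
    _ = _ := by ring

/-- The lower bound on the relaxation time for a given `b` that satisfies the inequality in the
definition of `b₀`. -/
theorem exists_rpow_le_treeRelaxationTime {ω : ℝ} (hω : 0 < ω) (hb : 2 ≤ b) (hx : 0.69 ≤ ω * b)
    (hexp : Real.exp (2 * 1.01 * (ω * b) ^ 2 / activity b ω) ≤ 1.01) :
    ∃ c : ℝ, 0 < c ∧ ∀ᶠ k : ℕ in atTop,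
      c * (numVertices b (k + 1) : ℝ) ^ exponent b ω ≤
        treeRelaxationTime b (k + 1) (activity b ω) (gammaU b ω k) ∧
      c * (numVertices b (k + 1) : ℝ) ^ exponent b ω ≤
        treeRelaxationTime b (k + 1) (activity b ω) (gammaL b ω k) := by
  obtain ⟨hx7, hlam202⟩ := activity_ge hω hb hx hexp
  have hlam := activity_pos (b := b) hω
  have hb0 : (0 : ℝ) < b := by exact_mod_cast (by omega : 0 < b)
  set lam := activity b ω with hlamdef
  set x := ω * b with hxdef
  have hx0 : 0 < x := by positivity
  have hsq : √lam ^ 2 = lam := Real.sq_sqrt hlam.le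
  have hsqrt : 101 ≤ √lam := Real.le_sqrt_of_sq_le (by nlinarith)
  have hp : (0 : ℝ) < (1 + ω) ^ b := by positivity
  have hlamp : lam = ω * (1 + ω) ^ b := rfl
  set a : ℝ := 1.01 / (1 + ω) ^ b with ha
  set φ : ℝ := 1.01 * x / √lam with hφ
  have hφpos : 0 < φ := by positivity
  have hφsq : φ ^ 2 = 1.01 ^ 2 * x ^ 2 / lam := by rw [hφ, div_pow, hsq]; ring
  have hφ1 : φ ≤ 1 := by
    have : φ ^ 2 ≤ 1 := by
      rw [hφsq, div_le_one hlam]; nlinarith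
    nlinarith
  have hba : b * a = 1.01 * x / lam := by
    rw [ha, hlamp, hxdef]; field_simp
  have hba' : b * a ≤ 1 / 2 := by
    rw [hba, div_le_iff₀ hlam]; nlinarith
  set y : ℝ := 1.01 * x ^ 2 / lam with hy
  have hy0 : 0 ≤ y := by positivity
  have hy1 : y ≤ 0.005 := by
    rw [hy, div_le_iff₀ hlam]; linarith
  -- `exp y ≤ √1.01`; the other half of the exponent makes room for the factors of `q`
  have hexpy : Real.exp y ≤ 1.005 := by
    have h1 : Real.exp y ^ 2 ≤ 1.01 := by
      rw [← Real.exp_nat_mul]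
      refine le_trans (le_of_eq ?_) hexp
      congr 1
      rw [hy]; push_cast; ring
    nlinarith [Real.exp_pos y]
  have hexpq : Real.exp (1.001 * y) ≤ 1.0051 := by
    have h1 : Real.exp (0.001 * y) ≤ 1.00001 := by
      have h5 := Real.add_one_le_exp (-(0.001 * y))
      rw [Real.exp_neg] at h5
      have h6 : Real.exp (0.001 * y) * (Real.exp (0.001 * y))⁻¹ = 1 :=
        mul_inv_cancel₀ (Real.exp_pos _).ne'
      nlinarith [Real.exp_pos (0.001 * y)]
    have h2 : Real.exp (1.001 * y) = Real.exp y * Real.exp (0.001 * y) := by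
      rw [← Real.exp_add]; congr 1; ring
    rw [h2]
    calc _ ≤ 1.005 * 1.00001 := mul_le_mul hexpy h1 (Real.exp_pos _).le (by norm_num)
      _ ≤ _ := by norm_num
  have hpow : (1 + b * a * (ω * 1.001)) ^ b ≤ 1.0051 := by
    have h1 : 1 + b * a * (ω * 1.001) ≤ Real.exp (b * a * (ω * 1.001)) := by
      rw [add_comm]; exact Real.add_one_le_exp _
    have h2 := pow_le_pow_left₀ (by positivity) h1 b
    rw [← Real.exp_nat_mul] at h2
    refine h2.trans (le_trans (le_of_eq ?_) hexpq)
    congr 1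
    rw [hba, hy, hxdef]; ring
  have hpow0 : 0 ≤ (1 + b * a * (ω * 1.001)) ^ b := by positivity
  have hstep0 : 1.001 * (1 + b * a * (ω * 1.001)) ^ b / (1 + ω) ^ b ≤ a := by
    exact div_le_div_of_nonneg_right (by linarith) hp.le
  have hstep1 : b * (φ + b * ω * 1.001) * (1.001 * (1 + b * a * (ω * 1.001)) ^ b / (1 + ω) ^ b) ≤
      φ ^ 2 := by
    have hφx : φ ≤ 0.01 * x := by
      rw [hφ, div_le_iff₀ (by linarith)]; nlinarith
    have h1 : 1.001 * (1 + b * a * (ω * 1.001)) ^ b / (1 + ω) ^ b ≤ 1.0062 / (1 + ω) ^ b :=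
      div_le_div_of_nonneg_right (by linarith) hp.le
    have h2 : φ + b * ω * 1.001 ≤ 1.011 * x := by rw [hxdef] at hφx ⊢; linarith
    calc _ ≤ b * (1.011 * x) * (1.0062 / (1 + ω) ^ b) := by
          refine mul_le_mul (mul_le_mul_of_nonneg_left h2 hb0.le) h1 (by positivity) (by positivity)
      _ = 1.011 * 1.0062 * x ^ 2 / lam := by rw [hlamp, hxdef]; field_simp
      _ ≤ φ ^ 2 := by
          rw [hφsq]
          refine div_le_div_of_nonneg_right ?_ hlam.le
          nlinarith [sq_nonneg x]
  obtain ⟨c, hc, hev⟩ := exists_le_treeRelaxationTime hω hb (by positivity) hba' hφpos hφ1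
    (by norm_num) (by norm_num) hstep0 hstep1
  have h2 : (0 : ℝ) < (2 : ℝ) ^ (exponent b ω - 1) := by positivity
  refine ⟨c / (2 : ℝ) ^ (exponent b ω - 1), by positivity, ?_⟩
  filter_upwards [hev] with k hk
  have hφeq : activity b ω / (1.01 * ω * b) ^ 2 = (φ ^ 2)⁻¹ := by
    rw [hφsq, inv_div, ← hlamdef, hxdef]; ring
  have hn := rpow_exponent_le (h := k + 1) hb hφpos hφ1 hφeq
  have hle : c / (2 : ℝ) ^ (exponent b ω - 1) * (numVertices b (k + 1) : ℝ) ^ exponent b ω ≤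
      c * ((numVertices b (k + 1) : ℝ) / φ ^ (k + 1)) := by
    rw [div_mul_eq_mul_div, div_le_iff₀ h2, mul_assoc]
    refine mul_le_mul_of_nonneg_left ?_ hc.le
    rw [mul_comm (_ / _)]
    exact hn
  exact ⟨hle.trans hk.1, hle.trans hk.2⟩

lemma le_omegaOf_mul (hδ : 0 < δ) (hb : 2 ≤ b) : 0.69 ≤ omegaOf δ b * b := by
  rw [omegaOf_mul hb]
  have h1 : Real.log 2 ≤ Real.log b := Real.log_le_log (by norm_num) (by exact_mod_cast hb)
  have h2 := Real.log_two_gt_d9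
  nlinarith

/-- The logarithm of `lam / (c ω b)²`, in terms of `b` and `δ`. -/
lemma log_activity_div (hδ : 0 < δ) (hb : 2 ≤ b) {c : ℝ} (hc : 0 < c) :
    Real.log (activity b (omegaOf δ b) / (c * omegaOf δ b * b) ^ 2) =
      b * Real.log (1 + omegaOf δ b) - Real.log b - Real.log (Real.log b) - Real.log (1 + δ) -
        2 * Real.log c := by
  have hω := omegaOf_pos hδ hb
  have hlog := log_pos_of_two_le hb
  have hb0 : (0 : ℝ) < b := by exact_mod_cast (by omega : 0 < b)
  have hlogω : Real.log (omegaOf δ b) =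
      Real.log (1 + δ) + Real.log (Real.log b) - Real.log b := by
    rw [omegaOf, Real.log_div (by positivity) hb0.ne', Real.log_mul (by positivity) hlog.ne']
  rw [Real.log_div (activity_pos hω).ne' (by positivity), activity,
    Real.log_mul hω.ne' (by positivity), Real.log_pow, Real.log_pow,
    Real.log_mul (by positivity) hb0.ne', Real.log_mul hc.ne' hω.ne', hlogω]
  push_cast
  ring

/-- `b ln (1 + ω)` is `ω b = (1 + δ) ln b` up to a bounded error. -/
lemma eventually_mul_log_one_add (hδ : 0 < δ) : ∀ᶠ b : ℕ in atTop,
    (1 + δ) * Real.log b - 1 ≤ b * Real.log (1 + omegaOf δ b) ∧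
      b * Real.log (1 + omegaOf δ b) ≤ (1 + δ) * Real.log b := by
  have hlit := ((Real.isLittleO_pow_log_id_atTop (n := 2)).comp_tendsto
    tendsto_natCast_atTop_atTop).bound (c := 2 / (1 + δ) ^ 2) (by positivity)
  filter_upwards [hlit, eventually_ge_atTop 2] with b hlb hb
  have hω := omegaOf_pos hδ hb
  have hx := omegaOf_mul (δ := δ) hb
  have hb0 : (0 : ℝ) < b := by exact_mod_cast (by omega : 0 < b)
  simp only [Function.comp_apply, id_eq, Real.norm_eq_abs, abs_pow, sq_abs, abs_of_pos hb0] at hlb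
  have hx2 : (omegaOf δ b * b) ^ 2 ≤ 2 * b := by
    rw [hx, mul_pow]
    rw [div_mul_eq_mul_div, le_div_iff₀ (by positivity)] at hlb
    linarith
  have hωx : omegaOf δ b * (omegaOf δ b * b) ≤ 2 := by
    refine le_of_mul_le_mul_right ?_ hb0
    calc _ = (omegaOf δ b * b) ^ 2 := by ring
      _ ≤ _ := hx2
  rw [← hx]
  constructor
  · have h1 := Real.le_log_one_add_of_nonneg hω.le
    have h2 : omegaOf δ b * b - 1 ≤ b * (2 * omegaOf δ b / (omegaOf δ b + 2)) := by
      rw [mul_div_assoc', le_div_iff₀ (by positivity)]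
      nlinarith
    exact h2.trans (mul_le_mul_of_nonneg_left h1 hb0.le)
  · have h1 := Real.log_le_sub_one_of_pos (by positivity : 0 < 1 + omegaOf δ b)
    nlinarith

/-- The set of admissible thresholds is not empty: `(ω b)² / lam` tends to zero. -/
lemma bZero_spec (hδ : 0 < δ) : 2 ≤ bZero δ ∧ ∀ b : ℕ, bZero δ ≤ b →
    Real.exp (2 * 1.01 * (omegaOf δ b * b) ^ 2 / activity b (omegaOf δ b)) ≤ 1.01 := by
  refine Nat.sInf_mem (s := {b₀ | 2 ≤ b₀ ∧ ∀ b : ℕ, b₀ ≤ b →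
    Real.exp (2 * 1.01 * (omegaOf δ b * b) ^ 2 / activity b (omegaOf δ b)) ≤ 1.01}) ?_
  have hlogb : Tendsto (fun b : ℕ => Real.log b) atTop atTop :=
    Real.tendsto_log_atTop.comp tendsto_natCast_atTop_atTop
  have hll := (Real.isLittleO_log_id_atTop.comp_tendsto hlogb).bound
    (c := δ / 2) (by positivity)
  have hbig := hlogb.eventually_ge_atTop (2 / δ * (1 + Real.log (1 + δ) + 7))
  have hev : ∀ᶠ b : ℕ in atTop,
      Real.exp (2 * 1.01 * (omegaOf δ b * b) ^ 2 / activity b (omegaOf δ b)) ≤ 1.01 := by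
    filter_upwards [hll, hbig, eventually_mul_log_one_add hδ, eventually_ge_atTop 2]
      with b h1 h2 h3 hb
    have hω := omegaOf_pos hδ hb
    have hlam := activity_pos (b := b) hω
    have hlog := log_pos_of_two_le hb
    have hb0 : (0 : ℝ) < b := by exact_mod_cast (by omega : 0 < b)
    simp only [Function.comp_apply, id_eq, Real.norm_eq_abs, abs_of_pos hlog] at h1
    have h4 := log_activity_div hδ hb one_pos
    rw [one_mul, Real.log_one] at h4
    have h5 : 1 + Real.log (1 + δ) + 7 ≤ δ / 2 * Real.log b := by
      calc _ = δ / 2 * (2 / δ * (1 + Real.log (1 + δ) + 7)) := by field_simp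
        _ ≤ _ := mul_le_mul_of_nonneg_left h2 (by positivity)
    have h6 : 7 ≤ Real.log (activity b (omegaOf δ b) / (omegaOf δ b * b) ^ 2) := by
      have := (le_abs_self _).trans h1
      linarith [h3.1]
    -- `404 = 2.02 / 0.005`, and `exp 0.005 ≤ 1.01`
    have h7 : (404 : ℝ) ≤ activity b (omegaOf δ b) / (omegaOf δ b * b) ^ 2 := by
      rw [Real.le_log_iff_exp_le (by positivity)] at h6
      refine le_trans ?_ h6
      have h8 := pow_le_pow_left₀ (by norm_num) Real.exp_one_gt_d9.le 7
      rw [← Real.exp_nat_mul] at h8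
      norm_num at h8
      linarith
    rw [le_div_iff₀ (by positivity)] at h7
    have h8 : 2 * 1.01 * (omegaOf δ b * b) ^ 2 / activity b (omegaOf δ b) ≤ 0.005 := by
      rw [div_le_iff₀ hlam]; linarith
    refine (Real.exp_le_exp.2 h8).trans ?_
    have h9 := Real.add_one_le_exp (-0.005)
    rw [Real.exp_neg] at h9
    have h10 : Real.exp 0.005 * (Real.exp 0.005)⁻¹ = 1 := mul_inv_cancel₀ (Real.exp_pos _).ne'
    nlinarith [Real.exp_pos 0.005]
  obtain ⟨N, hN⟩ := eventually_atTop.1 hev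
  exact ⟨max 2 N, le_max_left _ _, fun b hb => hN b ((le_max_right _ _).trans hb)⟩

/-- The exponent is `1 + δ / 2` up to an error of order `ln ln b / ln b`. -/
lemma exponent_isBigO (hδ : 0 < δ) :
    (fun b : ℕ => 1 + δ / 2 - exponent b (omegaOf δ b)) =O[atTop]
      fun b : ℕ => Real.log (Real.log (b : ℝ)) / Real.log (b : ℝ) := by
  have hlogb : Tendsto (fun b : ℕ => Real.log b) atTop atTop :=
    Real.tendsto_log_atTop.comp tendsto_natCast_atTop_atTop
  have hbig := (Real.tendsto_log_atTop.comp hlogb).eventually_ge_atTop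
    (1 + Real.log (1 + δ) + 2 * Real.log 1.01)
  refine IsBigO.of_bound 1 ?_
  filter_upwards [hbig, eventually_mul_log_one_add hδ, eventually_ge_atTop 2] with b h1 h2 hb
  have hlog := log_pos_of_two_le hb
  simp only [Function.comp_apply] at h1
  have hδ1 : 0 ≤ Real.log (1 + δ) := Real.log_nonneg (by linarith)
  have hc : 0 ≤ Real.log 1.01 := Real.log_nonneg (by norm_num)
  have h3 : 1 + δ / 2 - exponent b (omegaOf δ b) = (δ * Real.log b -
      Real.log (activity b (omegaOf δ b) / (1.01 * omegaOf δ b * b) ^ 2)) / (2 * Real.log b) := by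
    rw [exponent]; field_simp; ring
  rw [h3, log_activity_div hδ hb (by norm_num), one_mul, Real.norm_eq_abs, Real.norm_eq_abs,
    abs_of_nonneg (div_nonneg (by linarith [h2.2]) (by positivity)),
    abs_of_nonneg (div_nonneg (by linarith) hlog.le), div_le_div_iff₀ (by positivity) hlog]
  nlinarith [h2.1]

end Parameters

/-! ### Conclusion -/

section Positivity

variable {b h : ℕ} {lam : ℝ}

lemma one_le_treeRelaxationTime (hlam : 0 < lam) {Γ : Set (Vertex b (h + 1 + 1))}
    (hΓ : Γ ⊆ leaves b (h + 1 + 1)) : 1 ≤ treeRelaxationTime b (h + 1 + 1) lam Γ := by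
  have : Nonempty (Vertex b (h + 1 + 1)) := ⟨root b _⟩
  obtain ⟨hgap, -⟩ := spectralGap_glauber hlam (exists_config_ne hΓ) fun _ => True
  exact (one_le_inv₀ hgap).2 (spectralGap_le_one _)

end Positivity

end HardCore

end

theorem mainTheorem5 (δ : ℝ) (hδ : 0 < δ) :
    (∀ b : ℕ, HardCore.bZero δ ≤ b →
      (∃ c : ℝ, 0 < c ∧ ∀ᶠ k : ℕ in atTop,
        c * (HardCore.numVertices b (k + 1) : ℝ) ^ HardCore.exponent b (HardCore.omegaOf δ b) ≤
          HardCore.treeRelaxationTime b (k + 1) (HardCore.activity b (HardCore.omegaOf δ b))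
            (HardCore.gammaU b (HardCore.omegaOf δ b) k)) ∧
      (∃ c : ℝ, 0 < c ∧ ∀ᶠ k : ℕ in atTop,
        c * (HardCore.numVertices b (k + 1) : ℝ) ^ HardCore.exponent b (HardCore.omegaOf δ b) ≤
          HardCore.treeRelaxationTime b (k + 1) (HardCore.activity b (HardCore.omegaOf δ b))
            (HardCore.gammaL b (HardCore.omegaOf δ b) k))) ∧
    (∃ g : ℕ → ℝ,
      g =O[atTop] (fun b : ℕ => Real.log (Real.log (b : ℝ)) / Real.log (b : ℝ)) ∧
      ∀ b : ℕ, 2 ≤ b →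
        ∃ Γ : (h : ℕ) → Set (HardCore.Vertex b h), (∀ h, Γ h ⊆ HardCore.leaves b h) ∧
          ∃ c : ℝ, 0 < c ∧ ∀ᶠ h : ℕ in atTop,
            c * (HardCore.numVertices b h : ℝ) ^ (1 + δ / 2 - g b) ≤
              HardCore.treeRelaxationTime b h
                (HardCore.activity b (HardCore.omegaOf δ b)) (Γ h)) := by
  obtain ⟨h2, hspec⟩ := HardCore.bZero_spec hδ
  have hmain : ∀ b : ℕ, HardCore.bZero δ ≤ b → _ := fun b hb =>
    HardCore.exists_rpow_le_treeRelaxationTime (HardCore.omegaOf_pos hδ (h2.trans hb))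
      (h2.trans hb) (HardCore.le_omegaOf_mul hδ (h2.trans hb)) (hspec b hb)
  refine ⟨fun b hb => ?_, ?_⟩
  · obtain ⟨c, hc, hev⟩ := hmain b hb
    exact ⟨⟨c, hc, hev.mono fun _ h => h.1⟩, ⟨c, hc, hev.mono fun _ h => h.2⟩⟩
  · -- below the threshold the exponent is made zero
    refine ⟨fun b => if HardCore.bZero δ ≤ b then
      1 + δ / 2 - HardCore.exponent b (HardCore.omegaOf δ b) else 1 + δ / 2, ?_, ?_⟩
    · refine (HardCore.exponent_isBigO hδ).congr' ?_ EventuallyEq.rfl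
      filter_upwards [eventually_ge_atTop (HardCore.bZero δ)] with b hb
      rw [if_pos hb]
    · intro b hb
      by_cases hb0 : HardCore.bZero δ ≤ b
      · obtain ⟨c, hc, hev⟩ := hmain b hb0
        refine ⟨fun h => match h with
          | 0 => ∅
          | k + 1 => HardCore.gammaU b (HardCore.omegaOf δ b) k, ?_, c, hc, ?_⟩
        · rintro (_ | k)
          · exact Set.empty_subset _
          · exact (HardCore.gamma_subset b _ k).1
        · obtain ⟨N, hN⟩ := eventually_atTop.1 hev
          filter_upwards [eventually_ge_atTop (N + 1)] with h hh
          obtain ⟨k, rfl⟩ := Nat.exists_eq_add_of_le' (Nat.one_le_of_lt hh)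
          rw [if_pos hb0, sub_sub_cancel]
          exact (hN k (by omega)).1
      · refine ⟨fun _ => ∅, fun _ => Set.empty_subset _, 1, one_pos, ?_⟩
        filter_upwards [eventually_ge_atTop 2] with h hh
        obtain ⟨k, rfl⟩ := Nat.exists_eq_add_of_le' hh
        rw [if_neg hb0, sub_self, Real.rpow_zero, mul_one]
        exact HardCore.one_le_treeRelaxationTime
          (HardCore.activity_pos (HardCore.omegaOf_pos hδ hb)) (Set.empty_subset _)
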